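/- Consider a freight platform on a finite network whose lanes are all ordered pairs $(i,j)$ of nodes. In period $t$ the state consists of the numbers $S_{ijt}$ of available carriers and $D_{ijt}$ of loads on the lanes. The platform chooses shipper prices $r_{ijt}\ge 0$, which earn $r_{ijt}d_{ij}(r_{ijt})$ in expectation and make the demand $D_{ij,t+1}$ of the next period Poisson with mean $d_{ij}(r_{ijt})$, where $d_{ij}$ is strictly decreasing and the revenue $r_{ij}(d)\,d$ is concave in $d$ ($r_{ij}(\cdot)$ being the inverse demand function); it also runs a mechanism that allocates the loads to carriers and pays them. Carriers have independent private opportunity costs with distribution function $F_{ij}$ and density $f_{ij}$ and an increasing virtual cost $\psi_{ij}=\mathrm{id}+F_{ij}/f_{ij}$. Each unmatched load costs the platform a penalty $b_{ij}$. A carrier who has delivered a load to node $i$ becomes available on lane $(i,j)$ in the next period with probability $q_{ij}$, carriers without a load leave, and a Poisson number of new carriers with mean $\lambda_{ij}$ arrives on each lane. In the instance with scaling factor $\theta\in\{1,2,\dots\}$ the rates $d_{ij}$ and $\lambda_{ij}$ are multiplied by $\theta$. For a stationary policy $\pi$ let $\gamma^{\pi}(\theta)$ be the long-run average expected profit per period.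 Let $(d^*,\bar y^*,\bar\lambda^*)$ be an optimal solution of the fluid model: maximize $\sum_{(i,j)} r_{ij}(d_{ij})d_{ij}-F_{ij}^{-1}(\bar y_{ij}/\bar\lambda_{ij})\bar y_{ij}-b_{ij}(d_{ij}-\bar y_{ij})$ subject to $\sum_k q_{ij}\bar y_{ki}+\lambda_{ij}=\bar\lambda_{ij}$ and $0\le\bar y_{ij}\le\min(d_{ij},\bar\lambda_{ij})$. Put $r^*_{ij}=r_{ij}(d^*_{ij})$, $p^*_{ij}=F_{ij}^{-1}(\bar y^*_{ij}/\bar\lambda^*_{ij})$ and $\xi^*_{ij}=\max\{\psi_{ij}^{-1}(b_{ij}),p^*_{ij}\}$. The mechanism $\mathsf{SP}$ charges shippers $r^*$ and posts the prices $p^*$ to carriers in all states. The mechanism $\mathsf{AUC}$ charges shippers $r^*$ and in each period runs on each lane a sealed-bid uniform price auction with reserve price $\xi^*_{ij}$: the $D_{ijt}$ lowest bids not exceeding the reserve price win, and winner $s$ with bid $c_s$ is paid $c_s+\mathcal J(\mathbf c^{-s})-\mathcal J(\mathbf c)$, where $\mathcal J$ is the minimal total cost of assigning the $D_{ijt}$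 loads to the bidders and to dummy bidders who bid $\xi^*_{ij}$ (that is, each winner is paid the lower of the $(D_{ijt}+1)$-th lowest bid and the reserve price). Theorem. There is a problem instance, with opportunity costs uniform on $[0,1]$, all $q_{ij}=0$, Poisson demand and Poisson carrier arrivals, and a positive optimal value of the fluid model, for which $$\gamma^{\mathsf{AUC}}(\theta)-\gamma^{\mathsf{SP}}(\theta)\ge\Omega(\sqrt\theta)\qquad(\theta\to\infty),$$ and therefore $\gamma^{\mathsf{SP}}(\theta)/\gamma^{\mathsf{AUC}}(\theta)=1-\Omega(1/\sqrt\theta)$. Moreover, for this instance the gap between the optimal auction mechanism and the optimal posted price mechanism is also at least $\Omega(\sqrt\theta)$: there is $c>0$ such that, for all large $\theta$, the supremum of $\gamma^{\pi}(\theta)$ over all policies that charge shippers $r^*$ and use a Bayesian incentive compatible and individually rational direct mechanism for the carriers exceeds by at least $c\sqrt\theta$ the supremum over all posted price policies, in which the shipper prices and the prices posted to the carriers on each lane may depend on the state. -/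

import Mathlib

open MeasureTheory ProbabilityTheory Filter Topology Set

noncomputable section

namespace Freight

/-! ### Opportunity costs of the carriers -/

/-- The law on `ℝ` with density `f`. -/
def costLaw (f : ℝ → ℝ) : Measure ℝ := volume.withDensity fun c => ENNReal.ofReal (f c)

/-- The distribution function `F(c) = P(C ≤ c)` of the law with density `f`. -/
def costCdf (f : ℝ → ℝ) (c : ℝ) : ℝ := (costLaw f).real (Iic c)

/-- The inverse `F⁻¹ : [0, 1] → [lo, hi]` of the distribution function of a law on `[lo, hi]`. -/
def costQuantile (f : ℝ → ℝ) (lo hi x : ℝ) : ℝ := sInf {c ∈ Icc lo hi | x ≤ costCdf f c}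

/-- The virtual cost `ψ(c) = c + F(c) / f(c)`. -/
def virtualCost (f : ℝ → ℝ) (c : ℝ) : ℝ := c + costCdf f c / f c

/-- The inverse `ψ⁻¹(b)` of the (increasing) virtual cost function of a law on `[lo, hi]`; it is the
upper end of the cost range when `b` exceeds all virtual costs. -/
def virtualCostInv (f : ℝ → ℝ) (lo hi b : ℝ) : ℝ := sSup {c ∈ Ioo lo hi | virtualCost f c ≤ b}

/-! ### Problem instances -/

/-- Lanes: all origin-destination pairs of nodes, self-loops included. -/
abbrev Lane (n : ℕ) : Type := Fin n × Fin n

/-- A problem instance on the nodes `Fin n` (before scaling). -/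
structure Market (n : ℕ) where
  /-- mean `λ` of the number of new carriers per period on a lane -/
  arrival : Lane n → ℝ
  arrival_pos : ∀ e, 0 < arrival e
  /-- demand rate `d(r)` of a lane at the shipper price `r ≥ 0` -/
  demand : Lane n → ℝ → ℝ
  demand_nonneg : ∀ e r, 0 ≤ r → 0 ≤ demand e r
  demand_strictAnti : ∀ e, StrictAntiOn (demand e) (Ici 0)
  /-- the revenue `r(d) d`, with `r(d)` the inverse demand function, is concave -/
  revenue_concave : ∀ e, ConcaveOn ℝ (demand e '' Ici 0)
    fun d => Function.invFunOn (demand e) (Ici 0) d * d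
  /-- penalty cost `b` per unmatched load -/
  penalty : Lane n → ℝ
  penalty_nonneg : ∀ e, 0 ≤ penalty e
  /-- `stay (i, j)` is the probability that a carrier who has delivered a load to node `i` becomes
  available on the lane `(i, j)` in the next period -/
  stay : Lane n → ℝ
  stay_nonneg : ∀ e, 0 ≤ stay e
  stay_sum_le : ∀ i, ∑ j, stay (i, j) ≤ 1
  /-- density of the opportunity costs on a lane, and the range `[costLo, costHi]` of the costs -/
  costDensity : Lane n → ℝ → ℝ
  costLo : Lane n → ℝ
  costHi : Lane n → ℝ
  costLo_nonneg : ∀ e, 0 ≤ costLo e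
  costLo_lt_costHi : ∀ e, costLo e < costHi e
  costDensity_measurable : ∀ e, Measurable (costDensity e)
  costDensity_pos : ∀ e, ∀ c ∈ Ioo (costLo e) (costHi e), 0 < costDensity e c
  costDensity_zero : ∀ e, ∀ c ∉ Icc (costLo e) (costHi e), costDensity e c = 0
  costLaw_prob : ∀ e, IsProbabilityMeasure (costLaw (costDensity e))
  /-- `F⁻¹(x₁ / x₂) x₁` is convex and differentiable -/
  quantile_convex : ∀ e, ConvexOn ℝ {z : ℝ × ℝ | 0 ≤ z.1 ∧ z.1 ≤ z.2 ∧ 0 < z.2}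
    fun z => costQuantile (costDensity e) (costLo e) (costHi e) (z.1 / z.2) * z.1
  quantile_differentiable : ∀ e, DifferentiableOn ℝ
    (fun z : ℝ × ℝ => costQuantile (costDensity e) (costLo e) (costHi e) (z.1 / z.2) * z.1)
    {z | 0 < z.1 ∧ z.1 < z.2}
  /-- regularity: the virtual cost is strictly increasing -/
  virtualCost_strictMono : ∀ e,
    StrictMonoOn (virtualCost (costDensity e)) (Ioo (costLo e) (costHi e))

namespace Market

variable {n : ℕ} (M : Market n)

/-- The inverse demand function `r(d)`. -/
def shipperPrice (e : Lane n) (d : ℝ) : ℝ := Function.invFunOn (M.demand e) (Ici 0) d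

/-- `F⁻¹` on a lane. -/
def quantile (e : Lane n) (x : ℝ) : ℝ :=
  costQuantile (M.costDensity e) (M.costLo e) (M.costHi e) x

/-- The opportunity costs on every lane are uniform on `[0, 1]`. -/
def UniformCosts : Prop :=
  ∀ e, M.costLo e = 0 ∧ M.costHi e = 1 ∧ ∀ c ∈ Icc (0 : ℝ) 1, M.costDensity e c = 1

end Market

/-! ### The fluid model -/

/-- A candidate `(d, ȳ, λ̄)` for the fluid model. -/
structure FluidPoint (n : ℕ) where
  d : Lane n → ℝ
  y : Lane n → ℝ
  l : Lane n → ℝ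

namespace Market

variable {n : ℕ} (M : Market n)

/-- The constraints of the fluid model; demand rates are those that some shipper price induces. -/
def FluidFeasible (z : FluidPoint n) : Prop :=
  ∀ i j, (∑ k, M.stay (i, j) * z.y (k, i)) + M.arrival (i, j) = z.l (i, j) ∧
    z.d (i, j) ∈ M.demand (i, j) '' Ici 0 ∧
    0 ≤ z.y (i, j) ∧ z.y (i, j) ≤ z.d (i, j) ∧ z.y (i, j) ≤ z.l (i, j)

/-- The objective of the fluid model. -/
def fluidProfit (z : FluidPoint n) : ℝ :=
  ∑ e, (M.shipperPrice e (z.d e) * z.d e - M.quantile e (z.y e / z.l e) * z.y e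
    - M.penalty e * (z.d e - z.y e))

/-- `z` is an optimal solution of the fluid model. -/
def FluidOptimal (z : FluidPoint n) : Prop :=
  M.FluidFeasible z ∧ ∀ z', M.FluidFeasible z' → M.fluidProfit z' ≤ M.fluidProfit z

/-- The carrier price `p* = F⁻¹(ȳ* / λ̄*)`. -/
def fluidCarrierPrice (z : FluidPoint n) (e : Lane n) : ℝ := M.quantile e (z.y e / z.l e)

/-- The shipper price `r* = r(d*)`. -/
def fluidShipperPrice (z : FluidPoint n) (e : Lane n) : ℝ := M.shipperPrice e (z.d e)

/-- The reserve price `ξ* = max {ψ⁻¹(b), p*}`. -/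
def reserve (z : FluidPoint n) (e : Lane n) : ℝ :=
  max (virtualCostInv (M.costDensity e) (M.costLo e) (M.costHi e) (M.penalty e))
    (M.fluidCarrierPrice z e)

end Market

/-! ### Direct mechanisms for the carrier side -/

/-- A system state `(S, D)`: numbers of available carriers and of loads on the lanes. -/
abbrev State (n : ℕ) : Type := (Lane n → ℕ) × (Lane n → ℕ)

/-- The bids of the available carriers in a state. The carriers on a lane are numbered, say in the
order of their arrival. -/
abbrev Bids {n : ℕ} (x : State n) : Type := (e : Lane n) → Fin (x.1 e) → ℝ

/-- A direct mechanism for the carrier side. Given the state, the bids and a random seed (uniform on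
`[0, 1]`, independent of everything else), it selects the carriers who are allocated a load, at
most as many as there are loads on the lane, and it determines the payments. -/
structure Mechanism (n : ℕ) where
  winners : (x : State n) → Bids x → unitInterval → (e : Lane n) → Finset (Fin (x.1 e))
  card_winners_le : ∀ x c u e, (winners x c u e).card ≤ x.2 e
  measurable_winners : ∀ x e s, MeasurableSet {z : Bids x × unitInterval | s ∈ winners x z.1 z.2 e}
  pay : (x : State n) → Bids x → unitInterval → (e : Lane n) → Fin (x.1 e) → ℝ
  measurable_pay : ∀ x e s, Measurable fun z : Bids x × unitInterval => pay x z.1 z.2 e s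

/-- A stationary policy: in every state it sets shipper prices and runs a carrier mechanism. -/
structure Policy (n : ℕ) where
  price : State n → Lane n → ℝ
  price_nonneg : ∀ x e, 0 ≤ price x e
  mech : Mechanism n

/-- The bids in which carrier `s` on lane `e` bids `v` instead. -/
def setBid {n : ℕ} {x : State n} (c : Bids x) (e : Lane n) (s : Fin (x.1 e)) (v : ℝ) : Bids x :=
  Function.update c e (Function.update (c e) s v)

namespace Market

variable {n : ℕ} (M : Market n)

/-- The joint law of the (independent) opportunity costs of all carriers in a state and the seed. -/
def bidLaw (x : State n) : Measure (Bids x × unitInterval) :=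
  (Measure.pi fun e => Measure.pi fun _ : Fin (x.1 e) => costLaw (M.costDensity e)).prod volume

open Classical in
/-- The probability that carrier `s` on lane `e` is allocated a load when bidding `v`, the others
bidding their costs. -/
def interimAlloc (m : Mechanism n) (x : State n) (e : Lane n) (s : Fin (x.1 e)) (v : ℝ) : ℝ :=
  ∫ z, (if s ∈ m.winners x (setBid z.1 e s v) z.2 e then (1 : ℝ) else 0) ∂M.bidLaw x

/-- The expected payment to carrier `s` on lane `e` when bidding `v`, the others bidding their
costs. -/
def interimPay (m : Mechanism n) (x : State n) (e : Lane n) (s : Fin (x.1 e)) (v : ℝ) : ℝ :=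
  ∫ z, m.pay x (setBid z.1 e s v) z.2 e s ∂M.bidLaw x

/-- All expected payments, ex ante and interim, are finite. -/
def FinitePayments (m : Mechanism n) : Prop :=
  ∀ x e s, Integrable (fun z => m.pay x z.1 z.2 e s) (M.bidLaw x) ∧
    ∀ v ∈ Icc (M.costLo e) (M.costHi e),
      Integrable (fun z => m.pay x (setBid z.1 e s v) z.2 e s) (M.bidLaw x)

/-- Bayesian incentive compatibility. -/
def IncentiveCompatible (m : Mechanism n) : Prop :=
  ∀ x e s, ∀ c ∈ Icc (M.costLo e) (M.costHi e), ∀ v ∈ Icc (M.costLo e) (M.costHi e),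
    M.interimPay m x e s v - M.interimAlloc m x e s v * c ≤
      M.interimPay m x e s c - M.interimAlloc m x e s c * c

/-- Individual rationality. -/
def IndividuallyRational (m : Mechanism n) : Prop :=
  ∀ x e s, ∀ c ∈ Icc (M.costLo e) (M.costHi e),
    0 ≤ M.interimPay m x e s c - M.interimAlloc m x e s c * c

/-! ### The Markov decision process -/

/-- Law of the numbers of carriers that choose the alternatives `j` when each of `k` carriers
independently chooses `j` with probability `p j` and leaves with the remaining probability. -/
def multinomialLaw (p : Fin n → ℝ) : ℕ → Measure (Fin n → ℕ)
  | 0 => Measure.dirac 0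
  | k + 1 => (multinomialLaw p k).bind fun w =>
      (∑ j, ENNReal.ofReal (p j) • Measure.dirac (w + Pi.single j 1)) +
        ENNReal.ofReal (1 - ∑ j, p j) • Measure.dirac w

/-- Law of the numbers `Z` of carriers who stay, when `y e` loads have been delivered on the lanes
`e`. -/
def stayLaw (y : Lane n → ℕ) : Measure (Lane n → ℕ) :=
  (Measure.pi fun i => multinomialLaw (fun j => M.stay (i, j)) (∑ k, y (k, i))).map
    fun w e => w e.1 e.2

/-- Law of the numbers `Y` of loads transported in state `x` (carriers bid their true costs). -/
def transportedLaw (m : Mechanism n) (x : State n) : Measure (Lane n → ℕ) :=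
  (M.bidLaw x).map fun z e => (m.winners x z.1 z.2 e).card

/-- Law of the next state `(Z + Λ, D)` from state `x` in the instance with scaling factor `θ`:
new carriers are Poisson with means `θ λ`, new loads are Poisson with means `θ d(r)`. -/
def nextLaw (θ : ℕ) (π : Policy n) (x : State n) : Measure (State n) :=
  (((M.transportedLaw π.mech x).bind M.stayLaw).prod
    ((Measure.pi fun e => poissonMeasure (θ * M.arrival e).toNNReal).prod
      (Measure.pi fun e => poissonMeasure (θ * M.demand e (π.price x e)).toNNReal))).map
    fun w => (w.1 + w.2.1, w.2.2)

/-- Law of the state after `t` periods, from the initial state `x₀`. -/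
def stateLaw (θ : ℕ) (π : Policy n) (x₀ : State n) : ℕ → Measure (State n)
  | 0 => Measure.dirac x₀
  | t + 1 => (stateLaw θ π x₀ t).bind (M.nextLaw θ π)

/-- The expected profit `E[∑ r d(r) - b (D - Y) - P | S, D]` of a period in state `x`. -/
def periodProfit (θ : ℕ) (π : Policy n) (x : State n) : ℝ :=
  ∫ z, ∑ e, (π.price x e * (θ * M.demand e (π.price x e))
      - M.penalty e * ((x.2 e : ℝ) - ((π.mech.winners x z.1 z.2 e).card : ℝ))
      - ∑ s, π.mech.pay x z.1 z.2 e s) ∂M.bidLaw x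

/-- The policy has the long-run average profit per period `γ` (whatever the initial state), all
expectations involved being finite. -/
def HasAverageProfit (θ : ℕ) (π : Policy n) (γ : ℝ) : Prop :=
  M.FinitePayments π.mech ∧ ∀ x₀,
    (∀ t, Integrable (M.periodProfit θ π) (M.stateLaw θ π x₀ t)) ∧
    Tendsto (fun T : ℕ =>
        (∑ t ∈ Finset.range T, ∫ x, M.periodProfit θ π x ∂M.stateLaw θ π x₀ t) / T)
      atTop (𝓝 γ)

end Market

/-! ### Posted prices -/

/-- If every element of `W` precedes, within a transitive trichotomous relation, fewer than `D`
elements, then `W` has at most `D` elements. -/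
theorem card_le_of_rank {m D : ℕ} (r : Fin m → Fin m → Prop) [DecidableRel r]
    (hirr : ∀ a, ¬ r a a) (htr : ∀ a b c, r a b → r b c → r a c) (W : Finset (Fin m))
    (htri : ∀ a ∈ W, ∀ b ∈ W, a ≠ b → r a b ∨ r b a)
    (hW : ∀ a ∈ W, (Finset.univ.filter fun b => r b a).card < D) : W.card ≤ D := by
  have key : ∀ a b, r a b → (Finset.univ.filter fun c => r c a).card <
      (Finset.univ.filter fun c => r c b).card := by
    intro a b hab
    apply Finset.card_lt_card
    refine ⟨fun c hc => ?_, fun h => ?_⟩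
    · simp only [Finset.mem_filter, Finset.mem_univ, true_and] at hc ⊢
      exact htr _ _ _ hc hab
    · have : a ∈ Finset.univ.filter fun c => r c a := h (by simpa using hab)
      simp only [Finset.mem_filter, Finset.mem_univ, true_and] at this
      exact hirr a this
  have h := Finset.card_le_card_of_injOn (s := W) (t := Finset.range D)
    (fun a => (Finset.univ.filter fun b => r b a).card)
    (fun a ha => by simpa using hW a ha)
    (fun a ha b hb hab => by
      by_contra hne
      rcases htri a ha b hb hne with h | h
      · exact absurd hab (key _ _ h).ne
      · exact absurd hab (key _ _ h).ne')
  simpa using h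

/-- The carriers who book a load at the posted price `p`: in the order of their arrival, all carriers
with cost at most `p`, as long as loads remain. -/
def postedWinners {m : ℕ} (c : Fin m → ℝ) (D : ℕ) (p : ℝ) : Finset (Fin m) :=
  Finset.univ.filter fun s =>
    c s ≤ p ∧ (Finset.univ.filter fun s' => c s' ≤ p ∧ s' < s).card < D

theorem card_postedWinners_le {m : ℕ} (c : Fin m → ℝ) (D : ℕ) (p : ℝ) :
    (postedWinners c D p).card ≤ D := by
  refine card_le_of_rank (fun a b => c a ≤ p ∧ a < b) (fun a h => lt_irrefl _ h.2)
    (fun a b d h1 h2 => ⟨h1.1, h1.2.trans h2.2⟩) _ (fun a ha b hb hne => ?_) (fun a ha => ?_)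
  · simp only [postedWinners, Finset.mem_filter, Finset.mem_univ, true_and] at ha hb
    rcases lt_or_gt_of_ne hne with h | h
    · exact Or.inl ⟨ha.1, h⟩
    · exact Or.inr ⟨hb.1, h⟩
  · simp only [postedWinners, Finset.mem_filter, Finset.mem_univ, true_and] at ha
    exact ha.2

theorem measurableSet_card_filter_lt {α : Type*} [MeasurableSpace α] {m : ℕ} (D : ℕ)
    (q : Fin m → α → Prop) [∀ a, DecidablePred fun s => q s a]
    (hq : ∀ s, MeasurableSet {a | q s a}) :
    MeasurableSet {a | (Finset.univ.filter fun s => q s a).card < D} := by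
  classical
  have : Measurable fun a => ∑ s, if q s a then 1 else 0 :=
    Finset.measurable_sum _ fun s _ => Measurable.ite (hq s) measurable_const measurable_const
  have h2 : {a | (Finset.univ.filter fun s => q s a).card < D} =
      (fun a => ∑ s, if q s a then 1 else 0) ⁻¹' Iio D := by
    ext a
    simp only [Finset.card_filter, mem_preimage, mem_Iio]
    rfl
  rw [h2]
  exact this measurableSet_Iio

theorem measurable_bid {n : ℕ} {x : State n} (e : Lane n) (s : Fin (x.1 e)) :
    Measurable fun z : Bids x × unitInterval => z.1 e s :=
  (measurable_pi_apply s).comp ((measurable_pi_apply e).comp measurable_fst)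

theorem measurableSet_postedWinners {n : ℕ} (x : State n) (e : Lane n) (s : Fin (x.1 e))
    (D : ℕ) (p : ℝ) :
    MeasurableSet {z : Bids x × unitInterval | s ∈ postedWinners (z.1 e) D p} := by
  simp only [postedWinners, Finset.mem_filter, Finset.mem_univ, true_and]
  refine (measurableSet_le (measurable_bid e s) measurable_const).inter ?_
  refine measurableSet_card_filter_lt D (fun s' (z : Bids x × unitInterval) => z.1 e s' ≤ p ∧ s' < s)
    fun s' => ?_
  exact (measurableSet_le (measurable_bid e s') measurable_const).inter (MeasurableSet.const _)

/-- The posted price mechanism that offers the price `p x e` to all carriers on lane `e` in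
state `x`. -/
def postedPrice {n : ℕ} (p : State n → Lane n → ℝ) : Mechanism n where
  winners x c _ e := postedWinners (c e) (x.2 e) (p x e)
  card_winners_le _ _ _ _ := card_postedWinners_le _ _ _
  measurable_winners x e s := measurableSet_postedWinners x e s _ _
  pay x c _ e s := if s ∈ postedWinners (c e) (x.2 e) (p x e) then p x e else 0
  measurable_pay x e s :=
    Measurable.ite (measurableSet_postedWinners x e s _ _) measurable_const measurable_const

/-! ### Uniform price auctions -/

/-- The feasible allocations `(A, Y⁰)` of `D` loads to the bidders in `B` and dummy bidders. -/
def allocations {m : ℕ} (B : Finset (Fin m)) (D : ℕ) : Set ((Fin m → ℝ) × ℝ) :=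
  {a | (∀ s ∈ B, 0 ≤ a.1 s ∧ a.1 s ≤ 1) ∧ 0 ≤ a.2 ∧ ∑ s ∈ B, a.1 s + a.2 = D}

/-- The cost of an allocation to the bidders in `B`, dummy bidders bidding the reserve price `ξ`. -/
def allocationCost {m : ℕ} (B : Finset (Fin m)) (c : Fin m → ℝ) (ξ : ℝ) (a : (Fin m → ℝ) × ℝ) : ℝ :=
  ∑ s ∈ B, c s * a.1 s + ξ * a.2

/-- The optimal value `𝓙` of the allocation problem with the bidders in `B`. -/
def allocationValue {m : ℕ} (B : Finset (Fin m)) (c : Fin m → ℝ) (D : ℕ) (ξ : ℝ) : ℝ :=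
  sInf (allocationCost B c ξ '' allocations B D)

/-- Loads are allocated to the `D` lowest bids that do not exceed the reserve price `ξ`; ties (which
have probability zero) are broken by the numbering of the carriers. -/
def auctionWinners {m : ℕ} (c : Fin m → ℝ) (D : ℕ) (ξ : ℝ) : Finset (Fin m) :=
  Finset.univ.filter fun s =>
    c s ≤ ξ ∧ (Finset.univ.filter fun s' => c s' < c s ∨ (c s' = c s ∧ s' < s)).card < D

/-- The payment `c_s A_s + 𝓙(c without s) - 𝓙(c)`. -/
def auctionPay {m : ℕ} (c : Fin m → ℝ) (D : ℕ) (ξ : ℝ) (s : Fin m) : ℝ :=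
  (if s ∈ auctionWinners c D ξ then c s else 0)
    + allocationValue (Finset.univ.erase s) c D ξ - allocationValue Finset.univ c D ξ

theorem card_auctionWinners_le {m : ℕ} (c : Fin m → ℝ) (D : ℕ) (ξ : ℝ) :
    (auctionWinners c D ξ).card ≤ D := by
  refine card_le_of_rank (fun a b => c a < c b ∨ (c a = c b ∧ a < b)) (fun a h => by simp at h)
    (fun a b d h1 h2 => ?_) _ (fun a ha b hb hne => ?_) (fun a ha => ?_)
  · rcases h1 with h1 | h1 <;> rcases h2 with h2 | h2
    · exact Or.inl (h1.trans h2)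
    · exact Or.inl (h2.1 ▸ h1)
    · exact Or.inl (h1.1 ▸ h2)
    · exact Or.inr ⟨h1.1.trans h2.1, h1.2.trans h2.2⟩
  · rcases lt_trichotomy (c a) (c b) with h | h | h
    · exact Or.inl (Or.inl h)
    · rcases lt_or_gt_of_ne hne with h' | h'
      · exact Or.inl (Or.inr ⟨h, h'⟩)
      · exact Or.inr (Or.inr ⟨h.symm, h'⟩)
    · exact Or.inr (Or.inl h)
  · simp only [auctionWinners, Finset.mem_filter, Finset.mem_univ, true_and] at ha
    exact ha.2

theorem allocations_nonempty {m : ℕ} (B : Finset (Fin m)) (D : ℕ) : (allocations B D).Nonempty :=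
  ⟨(0, D), by simp [allocations]⟩

theorem bddBelow_allocationCost {m : ℕ} (B : Finset (Fin m)) (c : Fin m → ℝ) (D : ℕ) (ξ : ℝ) :
    BddBelow (allocationCost B c ξ '' allocations B D) := by
  refine ⟨-(∑ s ∈ B, |c s|) - |ξ| * D, ?_⟩
  rintro _ ⟨a, ⟨h1, h2, h3⟩, rfl⟩
  have h4 : -(∑ s ∈ B, |c s|) ≤ ∑ s ∈ B, c s * a.1 s := by
    rw [← Finset.sum_neg_distrib]
    refine Finset.sum_le_sum fun s hs => ?_
    have := h1 s hs
    have h5 : |c s * a.1 s| ≤ |c s| := by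
      rw [abs_mul, abs_of_nonneg this.1]
      exact mul_le_of_le_one_right (abs_nonneg _) this.2
    linarith [neg_abs_le (c s * a.1 s)]
  have h5 : 0 ≤ ∑ s ∈ B, a.1 s := Finset.sum_nonneg fun s hs => (h1 s hs).1
  have h6 : |ξ * a.2| ≤ |ξ| * D := by
    rw [abs_mul, abs_of_nonneg h2]
    exact mul_le_mul_of_nonneg_left (by linarith) (abs_nonneg _)
  unfold allocationCost
  linarith [neg_abs_le (ξ * a.2)]

/-- The winners of the auction are an optimal solution of the allocation problem. -/
theorem auctionWinners_optimal {m : ℕ} (c : Fin m → ℝ) (D : ℕ) (ξ : ℝ) :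
    allocationValue Finset.univ c D ξ =
      ∑ s ∈ auctionWinners c D ξ, c s + ξ * ((D : ℝ) - (auctionWinners c D ξ).card) := by
  classical
  set W := auctionWinners c D ξ with hWdef
  have hmem : ∀ s, s ∈ W ↔ c s ≤ ξ ∧
      (Finset.univ.filter fun s' => c s' < c s ∨ (c s' = c s ∧ s' < s)).card < D := by
    intro s
    simp [hWdef, auctionWinners]
  have hcard : W.card ≤ D := card_auctionWinners_le c D ξ
  have hcard' : (W.card : ℝ) ≤ D := by exact_mod_cast hcard
  have hout : ∀ s ∈ W, ∀ t, t ∉ W → c s ≤ c t := by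
    intro s hs t ht
    by_contra hlt
    push Not at hlt
    obtain ⟨h1, h2⟩ := (hmem s).1 hs
    refine ht ((hmem t).2 ⟨hlt.le.trans h1, lt_of_le_of_lt (Finset.card_le_card ?_) h2⟩)
    intro b hb
    simp only [Finset.mem_filter, Finset.mem_univ, true_and] at hb ⊢
    rcases hb with hb | hb
    · exact Or.inl (hb.trans hlt)
    · exact Or.inl (hb.1 ▸ hlt)
  have hfull : W.card < D → ∀ t, t ∉ W → ξ ≤ c t := by
    intro hlt t0 ht0
    by_contra hc
    push Not at hc
    obtain ⟨t, ht, hmin⟩ := Finset.exists_min_image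
      (Finset.univ.filter fun t => t ∉ W ∧ c t ≤ ξ) (fun t => toLex (c t, t))
      ⟨t0, by simpa using ⟨ht0, hc.le⟩⟩
    simp only [Finset.mem_filter, Finset.mem_univ, true_and] at ht hmin
    refine ht.1 ((hmem t).2 ⟨ht.2, lt_of_le_of_lt (Finset.card_le_card ?_) hlt⟩)
    intro b hb
    simp only [Finset.mem_filter, Finset.mem_univ, true_and] at hb
    by_contra hbW
    have hbξ : c b ≤ ξ := by
      rcases hb with hb | hb
      · exact hb.le.trans ht.2
      · exact hb.1.le.trans ht.2
    have h1 := hmin b ⟨hbW, hbξ⟩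
    rw [Prod.Lex.le_iff] at h1
    simp only [ofLex_toLex] at h1
    rcases hb with hb | hb <;> rcases h1 with h1 | h1
    · exact lt_asymm hb h1
    · exact hb.ne' h1.1
    · exact h1.ne' hb.1
    · exact absurd h1.2 (not_le.2 hb.2)
  obtain ⟨τ, h1, h2, h3, h4⟩ : ∃ τ, τ ≤ ξ ∧ (∀ s ∈ W, c s ≤ τ) ∧ (∀ t, t ∉ W → τ ≤ c t) ∧
      (ξ - τ) * ((D : ℝ) - W.card) = 0 := by
    rcases hcard.lt_or_eq with hlt | heq
    · exact ⟨ξ, le_rfl, fun s hs => ((hmem s).1 hs).1, hfull hlt, by simp⟩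
    · rcases W.eq_empty_or_nonempty with he | hne
      · refine ⟨min ξ (-∑ s, |c s|), min_le_left _ _, by simp [he], fun t _ => ?_, by simp [← heq]⟩
        have := Finset.single_le_sum (f := fun s => |c s|) (fun s _ => abs_nonneg _)
          (Finset.mem_univ t)
        exact (min_le_right _ _).trans (by linarith [neg_abs_le (c t)])
      · obtain ⟨s0, hs0, hmax⟩ := Finset.exists_max_image W c hne
        exact ⟨c s0, ((hmem s0).1 hs0).1, hmax, hout s0 hs0, by simp [← heq]⟩
  apply le_antisymm
  · refine csInf_le (bddBelow_allocationCost _ _ _ _)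
      ⟨(fun s => if s ∈ W then 1 else 0, (D : ℝ) - W.card), ⟨fun s _ => ?_, ?_, ?_⟩, ?_⟩
    · dsimp only
      split_ifs <;> norm_num
    · simpa using hcard
    · simp
    · simp [allocationCost]
  · refine le_csInf ((allocations_nonempty _ _).image _) ?_
    rintro _ ⟨a, ⟨ha, ha2, hsum⟩, rfl⟩
    have e1 : ∑ s ∈ W, (c s - τ) ≤ ∑ s, (c s - τ) * a.1 s := by
      rw [← Finset.sum_filter_add_sum_filter_not Finset.univ (· ∈ W)]
      have f1 : Finset.univ.filter (· ∈ W) = W := by ext; simp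
      rw [f1]
      have g1 : ∑ s ∈ W, (c s - τ) ≤ ∑ s ∈ W, (c s - τ) * a.1 s :=
        Finset.sum_le_sum fun s hs => by nlinarith [h2 s hs, ha s (Finset.mem_univ s)]
      have g2 : 0 ≤ ∑ s ∈ Finset.univ.filter (fun s => s ∉ W), (c s - τ) * a.1 s :=
        Finset.sum_nonneg fun s hs => by
          have := h3 s (by simpa using hs)
          exact mul_nonneg (by linarith) (ha s (Finset.mem_univ s)).1
      linarith
    have e2 : ∑ s, (c s - τ) * a.1 s = ∑ s, c s * a.1 s - τ * ∑ s, a.1 s := by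
      simp only [sub_mul, Finset.sum_sub_distrib, Finset.mul_sum]
    have e3 : ∑ s ∈ W, (c s - τ) = ∑ s ∈ W, c s - τ * W.card := by
      simp [Finset.sum_sub_distrib, mul_comm]
    have e4 : 0 ≤ (ξ - τ) * a.2 := mul_nonneg (by linarith) ha2
    unfold allocationCost
    have e5 : ∑ s, a.1 s = D - a.2 := by linarith
    rw [e5] at e2
    nlinarith

theorem measurable_allocationValue {m : ℕ} (B : Finset (Fin m)) (D : ℕ) (ξ : ℝ) :
    Measurable fun c : Fin m → ℝ => allocationValue B c D ξ := by
  refine measurable_of_Iio fun v => ?_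
  have h : (fun c : Fin m → ℝ => allocationValue B c D ξ) ⁻¹' Iio v =
      ⋃ a ∈ allocations B D, {c | allocationCost B c ξ a < v} := by
    ext c
    simp only [mem_preimage, mem_Iio, allocationValue,
      csInf_lt_iff (bddBelow_allocationCost B c D ξ) ((allocations_nonempty B D).image _),
      exists_mem_image, mem_iUnion, mem_ofPred_eq, exists_prop]
  rw [h]
  refine IsOpen.measurableSet (isOpen_biUnion fun a _ => ?_)
  refine isOpen_lt ?_ continuous_const
  unfold allocationCost
  fun_prop

theorem measurableSet_auctionWinners {n : ℕ} (x : State n) (e : Lane n) (s : Fin (x.1 e))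
    (D : ℕ) (ξ : ℝ) :
    MeasurableSet {z : Bids x × unitInterval | s ∈ auctionWinners (z.1 e) D ξ} := by
  simp only [auctionWinners, Finset.mem_filter, Finset.mem_univ, true_and]
  refine (measurableSet_le (measurable_bid e s) measurable_const).inter ?_
  refine measurableSet_card_filter_lt D
    (fun s' (z : Bids x × unitInterval) => z.1 e s' < z.1 e s ∨ (z.1 e s' = z.1 e s ∧ s' < s))
    fun s' => ?_
  exact (measurableSet_lt (measurable_bid e s') (measurable_bid e s)).union
    ((measurableSet_eq_fun (measurable_bid e s') (measurable_bid e s)).inter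
      (MeasurableSet.const _))

/-- The uniform price auction with reserve prices `ξ`, run on every lane separately. -/
def uniformPriceAuction {n : ℕ} (ξ : Lane n → ℝ) : Mechanism n where
  winners x c _ e := auctionWinners (c e) (x.2 e) (ξ e)
  card_winners_le _ _ _ _ := card_auctionWinners_le _ _ _
  measurable_winners x e s := measurableSet_auctionWinners x e s _ _
  pay x c _ e s := auctionPay (c e) (x.2 e) (ξ e) s
  measurable_pay x e s := by
    have h : Measurable fun z : Bids x × unitInterval => z.1 e :=
      (measurable_pi_apply e).comp measurable_fst
    exact ((Measurable.ite (measurableSet_auctionWinners x e s _ _) (measurable_bid e s)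
      measurable_const).add ((measurable_allocationValue _ _ _).comp h)).sub
      ((measurable_allocationValue _ _ _).comp h)

namespace Market

variable {n : ℕ} (M : Market n)

theorem fluidShipperPrice_nonneg {z : FluidPoint n} (hz : M.FluidFeasible z) (e : Lane n) :
    0 ≤ M.fluidShipperPrice z e :=
  Function.invFunOn_mem (hz e.1 e.2).2.1

/-- `SP`: the prices `(r*, p*)` of the fluid solution are posted in all states. -/
def staticPosted (z : FluidPoint n) (hz : M.FluidFeasible z) : Policy n where
  price _ := M.fluidShipperPrice z
  price_nonneg _ := M.fluidShipperPrice_nonneg hz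
  mech := postedPrice fun _ => M.fluidCarrierPrice z

/-- `AUC`: the shipper prices are `r*`, and the carrier side is the uniform price auction with
reserve prices `ξ*`. -/
def staticAuction (z : FluidPoint n) (hz : M.FluidFeasible z) : Policy n where
  price _ := M.fluidShipperPrice z
  price_nonneg _ := M.fluidShipperPrice_nonneg hz
  mech := uniformPriceAuction (M.reserve z)

/-- The long-run average profits of all posted price mechanisms: shipper prices and posted carrier
prices may depend on the state. -/
def postedProfits (θ : ℕ) : Set ℝ :=
  {γ | ∃ π : Policy n, (∃ p, π.mech = postedPrice p) ∧ M.HasAverageProfit θ π γ}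

/-- The long-run average profits of all incentive compatible and individually rational direct
mechanisms for the carrier side, the shipper prices being the prices `r*`. -/
def auctionProfits (z : FluidPoint n) (θ : ℕ) : Set ℝ :=
  {γ | ∃ π : Policy n, π.price = (fun _ => M.fluidShipperPrice z) ∧
    M.IncentiveCompatible π.mech ∧ M.IndividuallyRational π.mech ∧ M.HasAverageProfit θ π γ}

end Market

end Freight

end

namespace Freight

/-! ### Moments of the Poisson law -/

/-! The instance is a single lane with arrival rate 4, penalty 2, uniform costs and revenue `3 √d -
d`. Its fluid optimum is unique: `d = y = 1`, `r* = 2`, `p* = 1/4`, value `7/4`. The virtual cost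
`2c` stays below the penalty, so the reserve price is 1 and binds nobody. No carrier returns, so
periods interact only through the shipper price, which fixes the mean demand of the next period.

The auction loses only a constant. With `m` carriers and `D` loads its expected cost is at most `D
(D + 1) / (m + 1)`, the mean of `D` times the `(D + 1)`-th order statistic when `D < m`
(`integral_auction_cost_le`). Since `r E[1 / (N + 1)] ≤ 1` for a Poisson variable `N` with mean `r`,
averaging over independent Poisson `m` (mean `4θ`) and `D` (mean `θ`) gives at most `θ/4 + 1/2`,
hence profit at least `7θ/4 - 1/2` (`auction_profit_bounds`).

A posted price loses order `√θ`. At price `p` the number `N` of willing carriers is binomial and at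
most `min D N` loads move, so either loads or willing carriers are wasted. The fluid cost `D²/m`
lies above its tangent `D/2 - m/16` at `D/m = 1/4`. The excess over this tangent combines `E (D -
N)⁺`, `E (N - D)⁺` and `m (p - 1/4)²`. If `p` is near `1/4`, the first two are together of order
`√m`, by a characteristic function estimate for the mean absolute deviation
(`le_integral_abs_countLe_sub`); otherwise the excess is of order `m`. This gives
`le_integral_clamped_cost`, uniformly in `D` and `p`, hence for prices chosen in any state.

The tangent is linear in `D`, so only the mean of the demand matters, and `r d - d/2 ≤ 3/2` bounds
revenue minus the cost that it causes one period later by `7θ/4 - postedLoss √θ`. Summing with this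
one-period shift bounds every posted price policy (`posted_average_le`). The auction is incentive
compatible and individually rational, so the same comparison separates the two suprema. -/

theorem poisson_weight_succ (r : NNReal) (n : ℕ) :
    Real.exp (-r) * (r : ℝ) ^ (n + 1) / ((n + 1).factorial : ℝ) * ((n : ℝ) + 1) =
      r * (Real.exp (-r) * (r : ℝ) ^ n / (n.factorial : ℝ)) := by
  rw [Nat.factorial_succ]
  have : (n.factorial : ℝ) ≠ 0 := by positivity
  have : (n : ℝ) + 1 ≠ 0 := by positivity
  push_cast
  field_simp
  ring

/-- The Chen-Stein identity of the Poisson law. -/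
theorem poisson_chenStein (r : NNReal) (g : ℕ → ℝ)
    (hg : Integrable (fun n => g (n + 1)) (poissonMeasure r)) :
    Integrable (fun n : ℕ => (n : ℝ) * g n) (poissonMeasure r) ∧
      ∫ n, (n : ℝ) * g n ∂poissonMeasure r = r * ∫ n, g (n + 1) ∂poissonMeasure r := by
  have hint : Integrable (fun n : ℕ => (n : ℝ) * g n) (poissonMeasure r) := by
    rw [integrable_poissonMeasure_iff] at hg ⊢
    rw [← summable_nat_add_iff 1]
    -- The term at 0 carries the factor 0, so the series may be shifted by one, where the Poisson
    -- weights satisfy `(n + 1) w (n + 1) = r w n`.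
    refine (hg.mul_left (r : ℝ)).congr fun n => ?_
    rw [norm_mul, ← mul_assoc, ← mul_assoc, ← poisson_weight_succ]
    have : ‖((n + 1 : ℕ) : ℝ)‖ = n + 1 := by
      rw [Real.norm_of_nonneg (by positivity)]; push_cast; rfl
    rw [this]
  refine ⟨hint, ?_⟩
  have h1 := hasSum_integral_poissonMeasure hint
  rw [← hasSum_nat_add_iff' 1] at h1
  have h2 := (hasSum_integral_poissonMeasure hg).mul_left (r : ℝ)
  simp only [Finset.range_one, Finset.sum_singleton, Nat.cast_zero, zero_mul, smul_zero,
    sub_zero] at h1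
  refine h1.unique (h2.congr_fun fun n => ?_)
  simp only [smul_eq_mul]
  rw [← mul_assoc, ← mul_assoc, ← poisson_weight_succ]
  push_cast
  ring

theorem integrable_poisson_id (r : NNReal) :
    Integrable (fun n : ℕ => (n : ℝ)) (poissonMeasure r) := by
  simpa using (poisson_chenStein r (fun _ => 1) (integrable_const _)).1

theorem integral_poisson_id (r : NNReal) : ∫ n : ℕ, (n : ℝ) ∂poissonMeasure r = r := by
  simpa using (poisson_chenStein r (fun _ => 1) (integrable_const _)).2

theorem integrable_poisson_sq (r : NNReal) :
    Integrable (fun n : ℕ => (n : ℝ) ^ 2) (poissonMeasure r) := by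
  have := (poisson_chenStein r (fun n => n)
    (by simpa using (integrable_poisson_id r).add (integrable_const 1))).1
  simpa [sq] using this

theorem integral_poisson_sq (r : NNReal) :
    ∫ n : ℕ, (n : ℝ) ^ 2 ∂poissonMeasure r = (r : ℝ) ^ 2 + r := by
  have := (poisson_chenStein r (fun n => n)
    (by simpa using (integrable_poisson_id r).add (integrable_const 1))).2
  simp only [← sq, Nat.cast_add, Nat.cast_one] at this
  rw [this, integral_add (integrable_poisson_id r) (integrable_const 1), integral_poisson_id]
  simp
  ring

theorem integrable_poisson_inv_succ (r : NNReal) :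
    Integrable (fun n : ℕ => ((n : ℝ) + 1)⁻¹) (poissonMeasure r) := by
  refine Integrable.of_bound .of_discrete 1 (ae_of_all _ fun n => ?_)
  rw [Real.norm_of_nonneg (by positivity)]
  exact inv_le_one_of_one_le₀ (by linarith [n.cast_nonneg (α := ℝ)])

theorem integral_poisson_inv_succ_le (r : NNReal) :
    r * ∫ n : ℕ, ((n : ℝ) + 1)⁻¹ ∂poissonMeasure r ≤ 1 := by
  -- With the convention `0⁻¹ = 0`, the function `n * n⁻¹` is the indicator of `n ≥ 1`, so the left
  -- side is the probability of a positive value.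
  obtain ⟨h1, h2⟩ := poisson_chenStein r (fun n => (n : ℝ)⁻¹)
    (by simpa using integrable_poisson_inv_succ r)
  simp only [Nat.cast_add, Nat.cast_one] at h2
  rw [← h2]
  calc ∫ n : ℕ, (n : ℝ) * (n : ℝ)⁻¹ ∂poissonMeasure r ≤ ∫ _n : ℕ, (1 : ℝ) ∂poissonMeasure r :=
        integral_mono h1 (integrable_const _) fun n => mul_inv_le_one
    _ = 1 := by simp

theorem integrable_poisson_sqrt (r : NNReal) :
    Integrable (fun n : ℕ => √(n : ℝ)) (poissonMeasure r) := by
  refine ((integrable_poisson_id r).add (integrable_const 1)).mono' .of_discrete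
    (ae_of_all _ fun n => ?_)
  rw [Real.norm_of_nonneg (Real.sqrt_nonneg _)]
  exact Real.sqrt_le_iff.2 ⟨by simp; positivity, by
    simp only [Pi.add_apply]; nlinarith [n.cast_nonneg (α := ℝ)]⟩

/-- The mean of the square root of a Poisson variable. -/
theorem le_integral_poisson_sqrt (r : NNReal) (hr : 1 ≤ r) :
    √(r : ℝ) / 2 ≤ ∫ n : ℕ, √(n : ℝ) ∂poissonMeasure r := by
  have hr1 : (1 : ℝ) ≤ r := by exact_mod_cast hr
  set m := √(r : ℝ) with hm
  have hm0 : 0 < m := Real.sqrt_pos.2 (by linarith)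
  have hm2 : m ^ 2 = r := Real.sq_sqrt (by linarith)
  -- A parabola in `n` through 0 and tangent to the square root at `n = r`. With `u = √n` the
  -- difference is a positive multiple of `u (m - u)² (2m + u)`. Its mean needs only two moments and
  -- equals `√r - 1 / (2√r)`, which is at least `√r / 2` once `r ≥ 1`.
  have key : ∀ n : ℕ, (3 * (n : ℝ) * m ^ 2 - (n : ℝ) ^ 2) * (2 * m ^ 3)⁻¹ ≤ √(n : ℝ) := by
    intro n
    set u := √(n : ℝ)
    have hu : 0 ≤ u := Real.sqrt_nonneg _
    have hn : (n : ℝ) = u ^ 2 := (Real.sq_sqrt n.cast_nonneg).symm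
    rw [hn, ← div_eq_mul_inv, div_le_iff₀ (by positivity)]
    have h : 0 ≤ u * ((m - u) ^ 2 * (2 * m + u)) := by positivity
    nlinarith
  calc m / 2 ≤ (3 * r * m ^ 2 - ((r : ℝ) ^ 2 + r)) * (2 * m ^ 3)⁻¹ := by
        rw [← div_eq_mul_inv, le_div_iff₀ (by positivity), ← hm2]
        nlinarith [mul_pos hm0 hm0, mul_nonneg (sq_nonneg m) (by nlinarith : 0 ≤ m ^ 2 - 1)]
    _ = ∫ n : ℕ, (3 * (n : ℝ) * m ^ 2 - (n : ℝ) ^ 2) * (2 * m ^ 3)⁻¹ ∂poissonMeasure r := by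
        rw [integral_mul_const, integral_sub (((integrable_poisson_id r).const_mul 3).mul_const _)
          (integrable_poisson_sq r), integral_mul_const, integral_const_mul, integral_poisson_id,
          integral_poisson_sq]
    _ ≤ _ := integral_mono (((((integrable_poisson_id r).const_mul 3).mul_const _).sub
        (integrable_poisson_sq r)).mul_const _) (integrable_poisson_sqrt r) key

/-! ### Product measures -/

/-- Resampling one coordinate, possibly in dependence of its old value, preserves a product law if
it preserves the law of that coordinate. -/
theorem measurePreserving_update {ι : Type*} [Fintype ι] [DecidableEq ι] {X : ι → Type*} {V : Type*}
    [∀ i, MeasurableSpace (X i)] [MeasurableSpace V] (μ : ∀ i, Measure (X i))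
    [∀ i, IsProbabilityMeasure (μ i)] (ν : Measure V) [IsProbabilityMeasure ν] (i : ι)
    (g : X i × V → X i) (hg : MeasurePreserving g ((μ i).prod ν) (μ i)) :
    MeasurePreserving (fun z : (∀ j, X j) × V => Function.update z.1 i (g (z.1 i, z.2)))
      ((Measure.pi μ).prod ν) (Measure.pi μ) := by
  have hgm := hg.measurable
  have hmeas : Measurable fun z : (∀ j, X j) × V => Function.update z.1 i (g (z.1 i, z.2)) := by
    refine measurable_pi_lambda _ fun j => ?_
    by_cases h : j = i
    · subst h
      simp only [Function.update_self]
      fun_prop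
    · simp only [Function.update_of_ne h]
      fun_prop
  refine ⟨hmeas, (Measure.pi_eq fun s hs => ?_).symm⟩
  have hS : MeasurableSet (Set.pi univ s) := MeasurableSet.univ_pi hs
  rw [Measure.map_apply hmeas hS, Measure.prod_apply_symm (hmeas hS)]
  -- For a fixed value of the extra randomness the preimage of a box is again a box, changed only in
  -- its side `i`.
  have h1 : ∀ v : V, (fun x => (x, v)) ⁻¹'
      ((fun z : (∀ j, X j) × V => Function.update z.1 i (g (z.1 i, z.2))) ⁻¹' Set.pi univ s) =
      Set.pi univ (Function.update s i ((fun y => g (y, v)) ⁻¹' s i)) := by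
    intro v
    ext x
    simp only [mem_preimage, Set.mem_pi, mem_univ, true_imp_iff]
    refine forall_congr' fun j => ?_
    by_cases h : j = i
    · subst h; simp
    · simp [h]
  have h2 : ∀ v : V, Measure.pi μ (Set.pi univ (Function.update s i ((fun y => g (y, v)) ⁻¹' s i))) =
      μ i ((fun y => g (y, v)) ⁻¹' s i) * ∏ j ∈ Finset.univ.erase i, μ j (s j) := by
    intro v
    rw [Measure.pi_pi, ← Finset.mul_prod_erase _ _ (Finset.mem_univ i), Function.update_self]
    congr 1
    refine Finset.prod_congr rfl fun j hj => ?_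
    rw [Function.update_of_ne (Finset.ne_of_mem_erase hj)]
  simp_rw [h1, h2]
  have h3 : Measurable fun v : V => μ i ((fun y => g (y, v)) ⁻¹' s i) :=
    measurable_measure_prodMk_right (hgm (hs i))
  rw [lintegral_mul_const _ h3]
  have h4 : ∫⁻ v, μ i ((fun y => g (y, v)) ⁻¹' s i) ∂ν = μ i (s i) := by
    rw [← hg.measure_preimage (hs i).nullMeasurableSet, Measure.prod_apply_symm (hgm (hs i))]
    rfl
  rw [h4, Finset.mul_prod_erase _ (fun j => μ j (s j)) (Finset.mem_univ i)]

/-- Among `n + 1` exchangeable values, the chance that at most `D` of the others do not exceed the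
first one is at most `(D + 1) / (n + 1)`. -/
theorem measure_card_le_le (μ : Measure ℝ) [IsProbabilityMeasure μ] (n D : ℕ) :
    ((n : ℝ) + 1) * (μ.prod (Measure.pi fun _ : Fin n => μ)).real
      {z | (Finset.univ.filter fun t => z.2 t ≤ z.1).card ≤ D} ≤ D + 1 := by
  classical
  set P := Measure.pi fun _ : Fin (n + 1) => μ
  -- The count includes `j` itself, hence the bound `D + 2` in place of `D + 1`.
  let B : Fin (n + 1) → Set (Fin (n + 1) → ℝ) := fun j =>
    {c | (Finset.univ.filter fun t => c t ≤ c j).card < D + 2}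
  have hB : ∀ j, MeasurableSet (B j) := fun j =>
    measurableSet_card_filter_lt (D + 2) (fun t (c : Fin (n + 1) → ℝ) => c t ≤ c j) fun t =>
      measurableSet_le (measurable_pi_apply t) (measurable_pi_apply j)
  have hsym : ∀ j, P.real (B j) = P.real (B 0) := by
    intro j
    have hmp := measurePreserving_piCongrLeft (fun _ : Fin (n + 1) => μ) (Equiv.swap 0 j)
    have h := hmp.measureReal_preimage (hB j).nullMeasurableSet
    rw [← h]
    congr 1
    ext c
    simp only [B, mem_preimage, mem_ofPred_eq]
    have e : ∀ t, MeasurableEquiv.piCongrLeft (fun _ : Fin (n + 1) => ℝ) (Equiv.swap 0 j) c t =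
        c (Equiv.swap 0 j t) := by
      intro t
      have := Equiv.piCongrLeft_apply_apply (fun _ : Fin (n + 1) => ℝ) (Equiv.swap 0 j) c
        (Equiv.swap 0 j t)
      rw [Equiv.swap_apply_self] at this
      exact this
    simp only [e, Equiv.swap_apply_right]
    rw [Finset.card_equiv (Equiv.swap 0 j) (t := Finset.univ.filter fun t => c t ≤ c 0)
      (fun t => by simp)]
  -- All indices whose event occurs have values not exceeding the largest among them, and at most `D
  -- + 1` values do not exceed that one.
  have hsum : ∀ c, ∑ j, (B j).indicator (fun _ => (1 : ℝ)) c ≤ D + 1 := by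
    intro c
    have h1 : ∑ j, (B j).indicator (fun _ => (1 : ℝ)) c =
        ((Finset.univ.filter fun j => c ∈ B j).card : ℝ) := by
      rw [Finset.card_filter]
      push_cast
      refine Finset.sum_congr rfl fun j _ => ?_
      by_cases h : c ∈ B j <;> simp [h]
    rw [h1]
    rcases (Finset.univ.filter fun j => c ∈ B j).eq_empty_or_nonempty with h | h
    · rw [h]; simp; positivity
    · obtain ⟨j, hj, hmax⟩ := Finset.exists_max_image _ c h
      have h2 : (Finset.univ.filter fun j => c ∈ B j) ⊆ Finset.univ.filter fun t => c t ≤ c j := by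
        intro t ht
        simpa using hmax t ht
      have h3 : (Finset.univ.filter fun t => c t ≤ c j).card < D + 2 := by simpa [B] using hj
      have := (Finset.card_le_card h2).trans (Nat.lt_succ_iff.1 h3)
      exact_mod_cast this
  have hint : ((n : ℝ) + 1) * P.real (B 0) ≤ D + 1 := by
    calc ((n : ℝ) + 1) * P.real (B 0) = ∑ j, P.real (B j) := by simp [hsym]
      _ = ∫ c, ∑ j, (B j).indicator (fun _ => (1 : ℝ)) c ∂P := by
          rw [integral_finsetSum _ fun j _ => (integrable_const _).indicator (hB j)]
          refine Finset.sum_congr rfl fun j _ => ?_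
          rw [integral_indicator_const _ (hB j)]
          simp
      _ ≤ ∫ _c, ((D : ℝ) + 1) ∂P := integral_mono
          (integrable_finsetSum _ fun j _ => (integrable_const _).indicator (hB j))
          (integrable_const _) hsum
      _ = D + 1 := by simp
  refine le_trans (le_of_eq ?_) hint
  congr 1
  have hmp := measurePreserving_piFinSuccAbove (fun _ : Fin (n + 1) => μ) 0
  have hset : MeasurableSet {z : ℝ × (Fin n → ℝ) |
      (Finset.univ.filter fun t => z.2 t ≤ z.1).card ≤ D} := by
    have := measurableSet_card_filter_lt (D + 1) (fun t (z : ℝ × (Fin n → ℝ)) => z.2 t ≤ z.1)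
      fun t => measurableSet_le ((measurable_pi_apply t).comp measurable_snd) measurable_fst
    simpa only [Nat.lt_succ_iff] using this
  have h := hmp.measureReal_preimage hset.nullMeasurableSet
  rw [← h]
  congr 1
  ext c
  -- Splitting off coordinate 0, which always counts itself, turns "fewer than `D + 2`" into "at
  -- most `D` of the others".
  simp only [B, mem_preimage, mem_ofPred_eq, Finset.card_filter, Fin.sum_univ_succ]
  simp [MeasurableEquiv.piFinSuccAbove, Fin.insertNthEquiv, Fin.tail]
  omega

/-! ### The number of uniform costs below a price -/

/-- The uniform law on `[0, 1]`. -/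
noncomputable abbrev unif : Measure ℝ := volume.restrict (Icc 0 1)

/-- The law of `m` independent uniform costs. -/
noncomputable abbrev unifPi (m : ℕ) : Measure (Fin m → ℝ) := Measure.pi fun _ => unif

instance : IsProbabilityMeasure unif := ⟨by simp⟩

theorem unif_real_Iic {p : ℝ} (h0 : 0 ≤ p) (h1 : p ≤ 1) : unif.real (Iic p) = p := by
  rw [measureReal_restrict_apply measurableSet_Iic]
  have : Iic p ∩ Icc 0 1 = Icc 0 p := by
    ext x
    simp only [mem_inter_iff, mem_Iic, mem_Icc]
    constructor <;> intro h <;> refine ⟨?_, ?_⟩ <;> [linarith; linarith; linarith; constructor] <;>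
      linarith
  rw [this]
  simp [h0]

theorem ae_unifPi (m : ℕ) : ∀ᵐ c ∂unifPi m, ∀ s, c s ∈ Icc (0 : ℝ) 1 :=
  ae_all_iff.2 fun s => (measurePreserving_eval (fun _ : Fin m => unif) s).quasiMeasurePreserving.ae
    (ae_restrict_mem measurableSet_Icc)

/-- The number of costs that do not exceed `p`. -/
noncomputable def countLe {m : ℕ} (c : Fin m → ℝ) (p : ℝ) : ℕ := (Finset.univ.filter fun s => c s ≤ p).card

theorem countLe_le {m : ℕ} (c : Fin m → ℝ) (p : ℝ) : countLe c p ≤ m :=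
  (Finset.card_filter_le _ _).trans (by simp)

theorem countLe_eq_sum {m : ℕ} (c : Fin m → ℝ) (p : ℝ) :
    (countLe c p : ℝ) = ∑ s, (Iic p).indicator (fun _ => (1 : ℝ)) (c s) := by
  rw [countLe, Finset.card_filter]
  push_cast
  exact Finset.sum_congr rfl fun s _ => by simp [Set.indicator_apply]

theorem measurable_countLe (m : ℕ) (p : ℝ) :
    Measurable fun c : Fin m → ℝ => (countLe c p : ℝ) := by
  simp only [countLe_eq_sum]
  exact Finset.measurable_sum _ fun s _ =>
    (measurable_const.indicator measurableSet_Iic).comp (measurable_pi_apply s)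

theorem integrable_countLe (m : ℕ) (p : ℝ) :
    Integrable (fun c : Fin m → ℝ => (countLe c p : ℝ)) (unifPi m) :=
  Integrable.of_bound (measurable_countLe m p).aestronglyMeasurable m (ae_of_all _ fun c => by
    rw [Real.norm_of_nonneg (by positivity)]
    exact_mod_cast countLe_le c p)

theorem integral_countLe (m : ℕ) {p : ℝ} (h0 : 0 ≤ p) (h1 : p ≤ 1) :
    ∫ c, (countLe c p : ℝ) ∂unifPi m = m * p := by
  simp only [countLe_eq_sum]
  have hmp : ∀ s : Fin m, MeasurePreserving (fun c : Fin m → ℝ => c s) (unifPi m) unif :=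
    fun s => measurePreserving_eval (fun _ => unif) s
  have hi : Integrable ((Iic p).indicator fun _ => (1 : ℝ)) unif :=
    (integrable_const _).indicator measurableSet_Iic
  have hi' : ∀ s : Fin m, Integrable
      (fun c : Fin m → ℝ => (Iic p).indicator (fun _ => (1 : ℝ)) (c s)) (unifPi m) :=
    fun s => (hmp s).integrable_comp_of_integrable hi
  rw [integral_finsetSum _ fun s _ => hi' s]
  have : ∀ s : Fin m, ∫ c, (Iic p).indicator (fun _ => (1 : ℝ)) (c s) ∂unifPi m = p := by
    intro s
    rw [← integral_map (φ := fun c : Fin m → ℝ => c s) (hmp s).measurable.aemeasurable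
      (by rw [(hmp s).map_eq]; exact hi.aestronglyMeasurable), (hmp s).map_eq,
      integral_indicator_const _ measurableSet_Iic, unif_real_Iic h0 h1]
    simp
  simp [this]

theorem integral_unif_ite {p : ℝ} (h0 : 0 ≤ p) (h1 : p ≤ 1) (w : ℂ) :
    ∫ x, (if x ≤ p then w else 1) ∂unif = 1 + p * (w - 1) := by
  have h : (fun x : ℝ => if x ≤ p then w else 1) =
      fun x => 1 + (Iic p).indicator (fun _ => w - 1) x := by
    ext x
    by_cases hx : x ≤ p <;> simp [hx]
  rw [h, integral_add (integrable_const _) ((integrable_const _).indicator measurableSet_Iic),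
    integral_indicator_const _ measurableSet_Iic, unif_real_Iic h0 h1]
  simp

/-- The squared modulus avoids complex logarithms and shows the decay through the variance `p (1 -
p)`. -/
theorem norm_bernoulli_charFun_sq (p t : ℝ) :
    ‖1 + (p : ℂ) * (Complex.exp (t * Complex.I) - 1)‖ ^ 2 =
      1 - 2 * p * (1 - p) * (1 - Real.cos t) := by
  rw [← Complex.normSq_eq_norm_sq, Complex.normSq_apply]
  simp only [Complex.add_re, Complex.one_re, Complex.mul_re, Complex.ofReal_re, Complex.sub_re,
    Complex.exp_ofReal_mul_I_re, Complex.ofReal_im, Complex.sub_im, Complex.exp_ofReal_mul_I_im,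
    Complex.one_im, Complex.add_im, Complex.mul_im]
  linear_combination p ^ 2 * Real.sin_sq_add_cos_sq t

/-- The exponential of the count is a product over independent carriers, so its mean is the `m`-th
power of a Bernoulli characteristic function. Centring at `x` only multiplies by a phase, and a real
part is at most the modulus; the bound is therefore uniform in `x`. -/
theorem integral_cos_countLe_le (m : ℕ) {p : ℝ} (h0 : 0 ≤ p) (h1 : p ≤ 1) (t x : ℝ) :
    ∫ c, Real.cos (t * (countLe c p - x)) ∂unifPi m ≤
      ‖1 + (p : ℂ) * (Complex.exp (t * Complex.I) - 1)‖ ^ m := by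
  set w := Complex.exp (t * Complex.I) with hw
  let F : (Fin m → ℝ) → ℂ := fun c => ∏ s, if c s ≤ p then w else 1
  have hF : ∀ c : Fin m → ℝ, F c = Complex.exp (((t * countLe c p : ℝ) : ℂ) * Complex.I) := by
    intro c
    simp only [F, Finset.prod_ite, Finset.prod_const, one_pow, mul_one]
    rw [hw, ← Complex.exp_nat_mul]
    congr 1
    simp only [countLe]
    push_cast
    ring
  have hFint : Integrable F (unifPi m) := by
    refine Integrable.of_bound (Measurable.aestronglyMeasurable ?_) 1 (ae_of_all _ fun c => ?_)
    · exact Finset.measurable_prod _ fun s _ => Measurable.ite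
        (measurableSet_le (measurable_pi_apply s) measurable_const) measurable_const measurable_const
    · rw [hF, Complex.norm_exp_ofReal_mul_I]
  have hre : ∀ c : Fin m → ℝ, Real.cos (t * (countLe c p - x)) =
      Complex.reCLM (Complex.exp (((-(t * x) : ℝ) : ℂ) * Complex.I) * F c) := by
    intro c
    rw [hF, ← Complex.exp_add, ← add_mul, ← Complex.ofReal_add, Complex.reCLM_apply,
      Complex.exp_ofReal_mul_I_re]
    congr 1
    ring
  simp only [hre]
  rw [ContinuousLinearMap.integral_comp_comm _ (hFint.const_mul _), integral_const_mul,
    Complex.reCLM_apply]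
  refine (Complex.re_le_norm _).trans ?_
  rw [norm_mul, Complex.norm_exp_ofReal_mul_I, one_mul]
  refine le_of_eq ?_
  rw [← integral_unif_ite h0 h1, ← norm_pow]
  congr 1
  have := integral_fintype_prod_eq_pow (ι := Fin m) (μ := unif)
    (fun y : ℝ => if y ≤ p then w else 1)
  rwa [Fintype.card_fin] at this

theorem integrable_abs_countLe_sub (m : ℕ) (p x : ℝ) :
    Integrable (fun c : Fin m → ℝ => |(countLe c p : ℝ) - x|) (unifPi m) :=
  ((integrable_countLe m p).sub (integrable_const x)).abs

/-- The mean absolute deviation of a binomial variable from any number is of order `√m`. -/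
theorem le_integral_abs_countLe_sub (m : ℕ) {p : ℝ} (h0 : 1 / 8 ≤ p) (h1 : p ≤ 3 / 8) (x : ℝ) :
    (1 - Real.exp (-(7 / 320))) * √(m : ℝ) ≤ ∫ c, |(countLe c p : ℝ) - x| ∂unifPi m := by
  rcases Nat.eq_zero_or_pos m with rfl | hm
  · simp only [CharP.cast_eq_zero, Real.sqrt_zero, mul_zero]
    exact integral_nonneg fun c => abs_nonneg _
  have hm1 : (1 : ℝ) ≤ m := by exact_mod_cast hm
  set r := √(m : ℝ) with hr
  have hr1 : 1 ≤ r := Real.one_le_sqrt.2 hm1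
  have hr2 : r ^ 2 = m := Real.sq_sqrt (by linarith)
  -- The frequency `1/√m` matches the standard deviation: the characteristic function there stays
  -- away from 1 uniformly in `m`.
  set t := r⁻¹ with ht
  have ht0 : 0 < t := by positivity
  have ht1 : t ≤ 1 := inv_le_one_of_one_le₀ hr1
  have hcos : Real.cos t ≤ 1 - t ^ 2 / 5 := by
    have hpi : Real.pi ^ 2 < 10 := by nlinarith [Real.pi_lt_d2, Real.pi_gt_three]
    have h := Real.cos_le_one_sub_mul_cos_sq (x := t)
      (by rw [abs_of_pos ht0]; linarith [Real.pi_gt_three])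
    have h2 : 1 / 5 ≤ 2 / Real.pi ^ 2 := by
      rw [div_le_div_iff₀ (by norm_num) (by positivity)]
      linarith
    nlinarith [sq_nonneg t]
  have hcharsq : ‖1 + (p : ℂ) * (Complex.exp (t * Complex.I) - 1)‖ ^ 2 ≤
      Real.exp (-(7 / 320) / m) ^ 2 := by
    rw [norm_bernoulli_charFun_sq, ← Real.exp_nat_mul]
    -- The variance `p (1 - p)` on `[1/8, 3/8]` is least at `1/8`. With `1 - cos t ≥ t²/5` this
    -- produces the constant `7/320 = (7/64)/5`.
    have h2 : 7 / 64 ≤ p * (1 - p) := by nlinarith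
    have h3 : t ^ 2 = (m : ℝ)⁻¹ := by rw [ht, inv_pow, hr2]
    have h4 : 2 * (7 / 64) * (t ^ 2 / 5) ≤ 2 * (p * (1 - p)) * (1 - Real.cos t) := by
      gcongr
      linarith
    have h5 := Real.add_one_le_exp (((2 : ℕ) : ℝ) * (-(7 / 320) / m))
    have h6 : ((2 : ℕ) : ℝ) * (-(7 / 320) / m) = -(2 * (7 / 64) * (t ^ 2 / 5)) := by
      rw [h3]; push_cast; ring
    rw [h6] at h5 ⊢
    linarith
  have hchar : ‖1 + (p : ℂ) * (Complex.exp (t * Complex.I) - 1)‖ ^ m ≤ Real.exp (-(7 / 320)) := by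
    have h := pow_le_pow_left₀ (norm_nonneg _)
      (le_of_sq_le_sq hcharsq (Real.exp_pos _).le) m
    rwa [← Real.exp_nat_mul, mul_div_cancel₀ _ (by positivity)] at h
  have hc := (integral_cos_countLe_le m (by linarith : 0 ≤ p) (by linarith) t x).trans hchar
  -- The elementary bound `1 - cos y ≤ |y|`, from `y²/2` for `|y| ≤ 2` and from 2 beyond.
  have hpt : ∀ c : Fin m → ℝ,
      (1 - Real.cos (t * (countLe c p - x))) * r ≤ |(countLe c p : ℝ) - x| := by
    intro c
    have h1 := Real.one_sub_sq_div_two_le_cos (x := t * (countLe c p - x))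
    have h2 := Real.neg_one_le_cos (t * (countLe c p - x))
    have h3 : 1 - Real.cos (t * (countLe c p - x)) ≤ |t * (countLe c p - x)| := by
      rw [← sq_abs] at h1
      rcases le_total |t * (countLe c p - x)| 2 with h | h
      · nlinarith [abs_nonneg (t * (countLe c p - x))]
      · linarith
    rw [abs_mul, abs_of_pos ht0] at h3
    calc (1 - Real.cos (t * (countLe c p - x))) * r ≤ t * |(countLe c p : ℝ) - x| * r := by gcongr
      _ = |(countLe c p : ℝ) - x| := by
        rw [ht]; field_simp
  have hci : Integrable (fun c : Fin m → ℝ => Real.cos (t * (countLe c p - x))) (unifPi m) :=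
    Integrable.of_bound (Real.measurable_cos.comp
      (((measurable_countLe m p).sub_const x).const_mul t)).aestronglyMeasurable 1
      (ae_of_all _ fun c => Real.abs_cos_le_one _)
  calc (1 - Real.exp (-(7 / 320))) * r
      ≤ (1 - ∫ c, Real.cos (t * (countLe c p - x)) ∂unifPi m) * r := by gcongr
    _ = ∫ c, (1 - Real.cos (t * (countLe c p - x))) * r ∂unifPi m := by
        rw [integral_mul_const, integral_sub (integrable_const _) hci]
        simp
    _ ≤ _ := integral_mono (((integrable_const _).sub hci).mul_const _)
        (integrable_abs_countLe_sub m p x) hpt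

/-! ### The cost of posting a price on one lane -/

theorem card_postedWinners_le_countLe {m : ℕ} (c : Fin m → ℝ) (D : ℕ) (p : ℝ) :
    (postedWinners c D p).card ≤ countLe c p := by
  refine Finset.card_le_card fun s hs => ?_
  simp only [postedWinners, Finset.mem_filter, Finset.mem_univ, true_and] at hs ⊢
  exact hs.1

theorem measurable_card_filter {α : Type*} [MeasurableSpace α] {m : ℕ} (W : α → Finset (Fin m))
    (hW : ∀ s, MeasurableSet {a | s ∈ W a}) : Measurable fun a => (W a).card := by
  classical
  have h : (fun a => (W a).card) = fun a => ∑ s, if s ∈ W a then 1 else 0 := by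
    ext a
    simp
  rw [h]
  exact Finset.measurable_sum _ fun s _ => Measurable.ite (hW s) measurable_const measurable_const

theorem measurable_card_postedWinners (m D : ℕ) (p : ℝ) :
    Measurable fun c : Fin m → ℝ => (postedWinners c D p).card := by
  refine measurable_card_filter _ fun s => ?_
  simp only [postedWinners, Finset.mem_filter, Finset.mem_univ, true_and]
  refine (measurableSet_le (measurable_pi_apply s) measurable_const).inter ?_
  exact measurableSet_card_filter_lt D (fun s' (c : Fin m → ℝ) => c s' ≤ p ∧ s' < s) fun s' =>
    (measurableSet_le (measurable_pi_apply s') measurable_const).inter (MeasurableSet.const _)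

theorem integrable_card_postedWinners (m D : ℕ) (p : ℝ) :
    Integrable (fun c : Fin m → ℝ => ((postedWinners c D p).card : ℝ)) (unifPi m) :=
  Integrable.of_bound (measurable_from_top.comp
    (measurable_card_postedWinners m D p)).aestronglyMeasurable D (ae_of_all _ fun c => by
      rw [Real.norm_of_nonneg (by positivity)]
      exact_mod_cast card_postedWinners_le c D p)

/-- The price `p` can be moved into `[0, 1]` without increasing the costs. -/
theorem le_posted_cost {m : ℕ} {c : Fin m → ℝ} (hc : ∀ s, c s ∈ Icc (0 : ℝ) 1) (D : ℕ) (p : ℝ) :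
    2 * (D : ℝ) - (2 - max 0 (min 1 p)) * min (D : ℝ) (countLe c (max 0 (min 1 p))) ≤
      2 * ((D : ℝ) - (postedWinners c D p).card) + p * (postedWinners c D p).card := by
  set q := max 0 (min 1 p) with hq
  set Y : ℝ := ((postedWinners c D p).card : ℝ) with hY
  have hY0 : 0 ≤ Y := by positivity
  have hYD : Y ≤ D := Nat.cast_le.2 <| card_postedWinners_le c D p
  have hYN : Y ≤ countLe c p := Nat.cast_le.2 <| card_postedWinners_le_countLe c D p
  have hq2 : 0 ≤ 2 - q := by
    have : q ≤ 1 := max_le zero_le_one (min_le_left _ _)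
    linarith
  have hN : countLe c p ≤ countLe c q := by
    refine Finset.card_le_card fun s hs => ?_
    simp only [Finset.mem_filter, Finset.mem_univ, true_and] at hs ⊢
    exact (le_min (hc s).2 hs).trans (le_max_right _ _)
  have hN' : (countLe c p : ℝ) ≤ countLe c q := by exact_mod_cast hN
  have hYmin : Y ≤ min (D : ℝ) (countLe c q) := le_min hYD (hYN.trans hN')
  -- Raising a negative price to 0 does not raise the payment, because nobody accepts a negative
  -- price; lowering a price above 1 to 1 only saves money.
  have hpq : q * Y ≤ p * Y := by
    rcases le_or_gt 0 p with hp | hp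
    · exact mul_le_mul_of_nonneg_right (max_le hp (min_le_right _ _)) hY0
    · have : countLe c p = 0 := by
        rw [countLe, Finset.card_eq_zero, Finset.filter_eq_empty_iff]
        intro s _ h
        linarith [(hc s).1]
      have : Y = 0 := le_antisymm (by rw [this] at hYN; simpa using hYN) hY0
      simp [this]
  nlinarith [mul_le_mul_of_nonneg_left hYmin hq2]

/-- The constant of the `√θ` loss of posted prices. -/
noncomputable def postedLoss : ℝ := (1 - Real.exp (-(7 / 320))) / 64

theorem postedLoss_pos : 0 < postedLoss := by
  have : Real.exp (-(7 / 320)) < 1 :=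
    (Real.exp_lt_exp.2 (by norm_num : (-(7 / 320) : ℝ) < 0)).trans_eq Real.exp_zero
  unfold postedLoss
  linarith

theorem postedLoss_le : postedLoss ≤ 1 / 64 := by
  have := Real.exp_pos (-(7 / 320))
  unfold postedLoss
  linarith

/-- By `min a b = (a + b - |a - b|) / 2`, the loss of matches is exactly a mean absolute deviation,
the quantity that anti-concentration controls. -/
theorem integral_min_countLe (m : ℕ) {p : ℝ} (h0 : 0 ≤ p) (h1 : p ≤ 1) (D : ℕ) :
    ∫ c, min (D : ℝ) (countLe c p) ∂unifPi m =
      (D + m * p - ∫ c, |(countLe c p : ℝ) - D| ∂unifPi m) / 2 := by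
  have h : ∀ c : Fin m → ℝ, min (D : ℝ) (countLe c p) =
      (D + countLe c p - |(countLe c p : ℝ) - D|) / 2 := by
    intro c
    rcases le_total (D : ℝ) (countLe c p) with h | h
    · rw [min_eq_left h, abs_of_nonneg (by linarith)]
      ring
    · rw [min_eq_right h, abs_of_nonpos (by linarith)]
      ring
  simp only [h]
  have h2 : Integrable (fun c : Fin m → ℝ => (D : ℝ) + countLe c p) (unifPi m) :=
    (integrable_const _).add (integrable_countLe m p)
  rw [integral_div, integral_sub h2
    (integrable_abs_countLe_sub m p D), integral_add (integrable_const _) (integrable_countLe m p),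
    integral_countLe m h0 h1]
  simp

theorem integrable_min_countLe (m : ℕ) (p : ℝ) (D : ℕ) :
    Integrable (fun c : Fin m → ℝ => min (D : ℝ) (countLe c p)) (unifPi m) :=
  (integrable_const _).inf (integrable_countLe m p)

/-- The fluid cost, linearized at the ratio `1 / 4` of loads to carriers, is exceeded by a term of
order `√m` at any posted price. -/
theorem le_integral_clamped_cost (m D : ℕ) {p : ℝ} (h0 : 0 ≤ p) (h1 : p ≤ 1) :
    (D : ℝ) / 2 - m / 16 + postedLoss * √(m : ℝ) ≤
      2 * D - (2 - p) * ∫ c, min (D : ℝ) (countLe c p) ∂unifPi m := by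
  rw [integral_min_countLe m h0 h1]
  set A := ∫ c, |(countLe c p : ℝ) - D| ∂unifPi m with hA
  have hm0 : (0 : ℝ) ≤ m := m.cast_nonneg
  have hsm : √(m : ℝ) ≤ m := by
    refine Real.sqrt_le_iff.2 ⟨hm0, ?_⟩
    exact_mod_cast Nat.le_self_pow two_ne_zero m
  have hs0 := Real.sqrt_nonneg (m : ℝ)
  have hl := postedLoss_le
  -- The divisor 64 in `postedLoss` makes this term no larger than `m (p - 1/4)²` outside `[1/8,
  -- 3/8]`.
  have hlm : postedLoss * √(m : ℝ) ≤ m / 64 := by nlinarith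
  have hP : (m : ℝ) * p - D ≤ A := by
    calc (m : ℝ) * p - D = ∫ c, ((countLe c p : ℝ) - D) ∂unifPi m := by
          rw [integral_sub (integrable_countLe m p) (integrable_const _), integral_countLe m h0 h1]
          simp
      _ ≤ A := integral_mono ((integrable_countLe m p).sub (integrable_const _))
          (integrable_abs_countLe_sub m p D) fun c => le_abs_self _
  have hQ : (D : ℝ) - m * p ≤ A := by
    calc (D : ℝ) - m * p = ∫ c, ((D : ℝ) - countLe c p) ∂unifPi m := by
          rw [integral_sub (integrable_const _) (integrable_countLe m p), integral_countLe m h0 h1]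
          simp
      _ ≤ A := integral_mono ((integrable_const _).sub (integrable_countLe m p))
          (integrable_abs_countLe_sub m p D) fun c => by
            dsimp only
            rw [abs_sub_comm]
            exact le_abs_self _
  have hR : A ≤ D + m * p := by
    calc A ≤ ∫ c, ((D : ℝ) + countLe c p) ∂unifPi m := by
          refine integral_mono (integrable_abs_countLe_sub m p D)
            ((integrable_const _).add (integrable_countLe m p)) fun c => ?_
          have h2 : (0 : ℝ) ≤ countLe c p := Nat.cast_nonneg _
          have h3 : (0 : ℝ) ≤ D := Nat.cast_nonneg _
          exact abs_le.2 ⟨by dsimp only; linarith, by dsimp only; linarith⟩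
      _ = D + m * p := by
          rw [integral_add (integrable_const _) (integrable_countLe m p), integral_countLe m h0 h1]
          simp
  -- `P` is the expected number of loads in excess of the willing carriers and `Q` that of willing
  -- carriers in excess of the loads; `A = P + Q` and `D - m p = P - Q`.
  set P := (A + (D - m * p)) / 2 with hPdef
  set Q := (A - (D - m * p)) / 2 with hQdef
  have hP0 : 0 ≤ P := by linarith
  have hQ0 : 0 ≤ Q := by linarith
  have hQm : Q ≤ m * p := by linarith
  have key : 2 * (D : ℝ) - (2 - p) * ((D + m * p - A) / 2) =
      D / 2 - m / 16 + (3 / 2 * P + (1 / 2 - p) * Q + m * (p - 1 / 4) ^ 2) := by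
    rw [hPdef, hQdef]; ring
  rw [key]
  suffices postedLoss * √(m : ℝ) ≤ 3 / 2 * P + (1 / 2 - p) * Q + m * (p - 1 / 4) ^ 2 by linarith
  -- Near `1/4` the coefficients of `P` and `Q` are at least `1/8` and the fluctuation `A` is of
  -- order `√m`. Farther away, up to `1/2`, the quadratic term alone suffices. Above `1/2` the
  -- coefficient of `Q` is negative, but `Q ≤ m p` and `(p - 1/4)² - p (p - 1/2) = 1/16`.
  by_cases hp : 1 / 8 ≤ p ∧ p ≤ 3 / 8
  · have h2 := le_integral_abs_countLe_sub m hp.1 hp.2 D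
    rw [← hA] at h2
    have h3 : postedLoss * √(m : ℝ) ≤ A / 64 := by
      unfold postedLoss
      linarith
    have h4 : A = P + Q := by rw [hPdef, hQdef]; ring
    have h5 : 0 ≤ (m : ℝ) * (p - 1 / 4) ^ 2 := by positivity
    nlinarith [hp.2]
  · rcases le_or_gt p (1 / 2) with h | h
    · have h2 : 1 / 64 ≤ (p - 1 / 4) ^ 2 := by
        rw [not_and_or, not_le, not_le] at hp
        rcases hp with hp | hp <;> nlinarith
      have h3 : 0 ≤ (1 / 2 - p) * Q := mul_nonneg (by linarith) hQ0
      nlinarith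
    · nlinarith [mul_le_mul_of_nonneg_left hQm (by linarith : (0 : ℝ) ≤ p - 1 / 2)]

/-- The expected costs of posting the price `p` to `m` carriers when there are `D` loads. -/
theorem le_integral_posted_cost (m D : ℕ) (p : ℝ) :
    max 0 ((D : ℝ) / 2 - m / 16 + postedLoss * √(m : ℝ)) ≤
      ∫ c, (2 * ((D : ℝ) - (postedWinners c D p).card) + p * (postedWinners c D p).card)
        ∂unifPi m := by
  have hq0 : 0 ≤ max 0 (min 1 p) := le_max_left _ _
  have hq1 : max 0 (min 1 p) ≤ 1 := max_le zero_le_one (min_le_left _ _)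
  set q := max 0 (min 1 p) with hq
  have hint := ((integrable_min_countLe m q D).const_mul (2 - q))
  have h1 : ∫ c, (2 * (D : ℝ) - (2 - q) * min (D : ℝ) (countLe c q)) ∂unifPi m ≤
      ∫ c, (2 * ((D : ℝ) - (postedWinners c D p).card) + p * (postedWinners c D p).card)
        ∂unifPi m := by
    refine integral_mono_ae ((integrable_const _).sub hint) ?_ ?_
    · exact (((integrable_const _).sub (integrable_card_postedWinners m D p)).const_mul 2).add
        ((integrable_card_postedWinners m D p).const_mul p)
    · filter_upwards [ae_unifPi m] with c hc using le_posted_cost hc D p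
  -- The truncation at 0 keeps the lower bound nonnegative, which later permits integration along
  -- transitions.
  refine le_trans (max_le ?_ ?_) h1
  · refine integral_nonneg fun c => ?_
    have h2 : min (D : ℝ) (countLe c q) ≤ D := min_le_left _ _
    have h3 : 0 ≤ min (D : ℝ) (countLe c q) := le_min (by positivity) (by positivity)
    simp only [Pi.zero_apply]
    nlinarith
  · rw [integral_sub (integrable_const _) hint]
    rw [integral_const, probReal_univ, one_smul, integral_const_mul]
    exact le_integral_clamped_cost m D hq0 hq1

/-! ### The uniform price auction on one lane -/

theorem allocationValue_le {m : ℕ} {B W : Finset (Fin m)} (hWB : W ⊆ B) (c : Fin m → ℝ) {D : ℕ}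
    (hW : W.card ≤ D) (ξ : ℝ) :
    allocationValue B c D ξ ≤ ∑ s ∈ W, c s + ξ * ((D : ℝ) - W.card) := by
  classical
  have hW' : (W.card : ℝ) ≤ D := by exact_mod_cast hW
  refine csInf_le (bddBelow_allocationCost _ _ _ _)
    ⟨(fun s => if s ∈ W then 1 else 0, (D : ℝ) - W.card), ⟨fun s _ => ?_, ?_, ?_⟩, ?_⟩
  · dsimp only
    split_ifs <;> norm_num
  · simpa using hW'
  · simp [Finset.inter_eq_right.2 hWB]
  · simp [allocationCost, Finset.inter_eq_right.2 hWB]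

/-- An allocation without bidder `s` extends by zero at `s` at the same cost. -/
theorem allocationValue_univ_le_erase {m : ℕ} (c : Fin m → ℝ) (D : ℕ) (ξ : ℝ) (s : Fin m) :
    allocationValue Finset.univ c D ξ ≤ allocationValue (Finset.univ.erase s) c D ξ := by
  refine le_csInf ((allocations_nonempty _ _).image _) ?_
  rintro _ ⟨a, ⟨h1, h2, h3⟩, rfl⟩
  have hs : ∀ f : Fin m → ℝ, ∑ t, f t * Function.update a.1 s 0 t =
      ∑ t ∈ Finset.univ.erase s, f t * a.1 t := by
    intro f
    rw [← Finset.add_sum_erase _ _ (Finset.mem_univ s)]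
    simp only [Function.update_self, mul_zero, zero_add]
    exact Finset.sum_congr rfl fun t ht => by
      rw [Function.update_of_ne (Finset.ne_of_mem_erase ht)]
  refine csInf_le (bddBelow_allocationCost _ _ _ _)
    ⟨(Function.update a.1 s 0, a.2), ⟨fun t _ => ?_, h2, ?_⟩, ?_⟩
  · by_cases h : t = s
    · subst h; simp
    · simpa [h] using h1 t (by simpa using h)
  · simpa [← h3] using hs fun _ => 1
  · simp [allocationCost, hs]

/-- This is the Groves property: the benchmark in the payment to `s` is out of the reach of the bid
of `s`. -/
theorem allocationValue_erase_update {m : ℕ} (c : Fin m → ℝ) (D : ℕ) (ξ : ℝ) (s : Fin m) (v : ℝ) :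
    allocationValue (Finset.univ.erase s) (Function.update c s v) D ξ =
      allocationValue (Finset.univ.erase s) c D ξ := by
  unfold allocationValue
  congr 1
  refine image_congr fun a _ => ?_
  unfold allocationCost
  congr 1
  exact Finset.sum_congr rfl fun t ht => by rw [Function.update_of_ne (Finset.ne_of_mem_erase ht)]

/-- A carrier whose cost is `c s` does not lose by taking part in the auction. -/
theorem auction_utility_nonneg {m : ℕ} (c : Fin m → ℝ) (D : ℕ) (ξ : ℝ) (s : Fin m) :
    (if s ∈ auctionWinners c D ξ then (1 : ℝ) else 0) * c s ≤ auctionPay c D ξ s := by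
  have := allocationValue_univ_le_erase c D ξ s
  unfold auctionPay
  split_ifs <;> linarith

/-- Bidding the true cost is a dominant strategy in the auction. -/
theorem auction_truthful {m : ℕ} (c : Fin m → ℝ) (D : ℕ) (ξ : ℝ) (s : Fin m) (v : ℝ) :
    auctionPay (Function.update c s v) D ξ s -
        (if s ∈ auctionWinners (Function.update c s v) D ξ then (1 : ℝ) else 0) * c s ≤
      auctionPay c D ξ s - (if s ∈ auctionWinners c D ξ then (1 : ℝ) else 0) * c s := by
  have h1 := auctionWinners_optimal (Function.update c s v) D ξ
  set W := auctionWinners (Function.update c s v) D ξ with hW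
  -- Bidding `v` yields a utility equal to the benchmark without `s` minus the cost, at the bids
  -- `c`, of the allocation `W` it induces; no allocation costs less than the optimum at `c`, which
  -- the bid `c s` achieves.
  have h2 := allocationValue_le (Finset.subset_univ W) c (card_auctionWinners_le _ D ξ) ξ
  have h3 : ∑ t ∈ W, Function.update c s v t - ∑ t ∈ W, c t = if s ∈ W then v - c s else 0 := by
    rw [← Finset.sum_sub_distrib]
    have : ∀ t ∈ W, Function.update c s v t - c t = if t = s then v - c s else 0 := by
      intro t _
      by_cases h : t = s
      · subst h; simp
      · simp [h]
    rw [Finset.sum_congr rfl this, Finset.sum_ite_eq']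
  unfold auctionPay
  rw [allocationValue_erase_update, ← hW, Function.update_self]
  by_cases hs : s ∈ W
  · simp only [hs, if_true] at h3 ⊢
    split_ifs <;> linarith
  · simp only [hs, if_false] at h3 ⊢
    split_ifs <;> linarith

/-- The winners remain a feasible choice when a loser is removed, so the loser's removal does not
raise the optimal cost. -/
theorem auctionPay_nonpos_of_notMem {m : ℕ} {c : Fin m → ℝ} {D : ℕ} {ξ : ℝ} {s : Fin m}
    (hs : s ∉ auctionWinners c D ξ) : auctionPay c D ξ s ≤ 0 := by
  have h1 := auctionWinners_optimal c D ξ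
  have h2 := allocationValue_le (B := Finset.univ.erase s) (W := auctionWinners c D ξ)
    (fun t ht => by
      simp only [Finset.mem_erase, Finset.mem_univ, and_true]
      rintro rfl
      exact hs ht) c (card_auctionWinners_le _ D ξ) ξ
  unfold auctionPay
  simp only [hs, if_false]
  linarith

/-- When winner `s` is removed, a dummy bidder can take over the load at the cost `ξ`. -/
theorem auctionPay_le_reserve {m : ℕ} {c : Fin m → ℝ} {D : ℕ} {ξ : ℝ} {s : Fin m}
    (hs : s ∈ auctionWinners c D ξ) : auctionPay c D ξ s ≤ ξ := by
  have h1 := auctionWinners_optimal c D ξ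
  have hcard := Finset.card_erase_add_one hs
  have h2 := allocationValue_le (B := Finset.univ.erase s) (W := (auctionWinners c D ξ).erase s)
    (Finset.erase_subset_erase _ (Finset.subset_univ _)) c
    ((Finset.card_erase_le).trans (card_auctionWinners_le _ D ξ)) ξ
  rw [← Finset.add_sum_erase _ _ hs, ← hcard] at h1
  push_cast at h1
  unfold auctionPay
  simp only [hs, if_true]
  linarith

/-- When winner `s` is removed, the losing bidder `t` can take over the load. Only this inequality,
not the exact payment, is needed to bound the expenses. -/
theorem auctionPay_le_loser {m : ℕ} {c : Fin m → ℝ} {D : ℕ} {ξ : ℝ} {s t : Fin m}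
    (hs : s ∈ auctionWinners c D ξ) (ht : t ∉ auctionWinners c D ξ) :
    auctionPay c D ξ s ≤ c t := by
  have h1 := auctionWinners_optimal c D ξ
  have hcard := Finset.card_erase_add_one hs
  have ht' : t ∉ (auctionWinners c D ξ).erase s := fun h => ht (Finset.mem_of_mem_erase h)
  have hts : t ≠ s := by
    rintro rfl
    exact ht hs
  have hins : (insert t ((auctionWinners c D ξ).erase s)).card = (auctionWinners c D ξ).card := by
    rw [Finset.card_insert_of_notMem ht', hcard]
  have h2 := allocationValue_le (B := Finset.univ.erase s)
    (W := insert t ((auctionWinners c D ξ).erase s))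
    (Finset.insert_subset (by simpa using hts)
      (Finset.erase_subset_erase _ (Finset.subset_univ _))) c
    (hins.le.trans (card_auctionWinners_le _ D ξ)) ξ
  rw [hins, Finset.sum_insert ht'] at h2
  rw [← Finset.add_sum_erase _ _ hs] at h1
  unfold auctionPay
  simp only [hs, if_true]
  linarith

theorem sum_auctionPay_le {m : ℕ} {c : Fin m → ℝ} {D : ℕ} {ξ b : ℝ}
    (hb : ∀ s ∈ auctionWinners c D ξ, auctionPay c D ξ s ≤ b) :
    ∑ s, auctionPay c D ξ s ≤ (auctionWinners c D ξ).card * b := by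
  have : ∀ s, auctionPay c D ξ s ≤ if s ∈ auctionWinners c D ξ then b else 0 := by
    intro s
    split_ifs with hs
    · exact hb s hs
    · exact auctionPay_nonpos_of_notMem hs
  refine (Finset.sum_le_sum fun s _ => this s).trans (le_of_eq ?_)
  simp

/-- If no bid exceeds the reserve price, as many loads as possible are allocated. -/
theorem min_le_card_auctionWinners {m : ℕ} {c : Fin m → ℝ} {ξ : ℝ} (hc : ∀ s, c s ≤ ξ) (D : ℕ) :
    min D m ≤ (auctionWinners c D ξ).card := by
  set W := auctionWinners c D ξ with hW
  rcases (Finset.univ.filter fun t => t ∉ W).eq_empty_or_nonempty with h | h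
  · have : W = Finset.univ := by
      ext t
      have := Finset.filter_eq_empty_iff.1 h (Finset.mem_univ t)
      simpa using this
    rw [this]
    simp
  -- The first loser in the order of bids and indices meets the reserve price, so it lost because at
  -- least `D` bidders precede it, and all of these are winners.
  · obtain ⟨t, ht, hmin⟩ := Finset.exists_min_image _ (fun t => toLex (c t, t)) h
    simp only [Finset.mem_filter, Finset.mem_univ, true_and] at ht hmin
    have hrank : ¬ (Finset.univ.filter fun s' => c s' < c t ∨ (c s' = c t ∧ s' < t)).card < D := by
      intro h
      exact ht (by simp [hW, auctionWinners, hc t, h])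
    refine (min_le_left _ _).trans ((not_lt.1 hrank).trans (Finset.card_le_card fun b hb => ?_))
    simp only [Finset.mem_filter, Finset.mem_univ, true_and] at hb
    by_contra hbW
    have h1 := hmin b hbW
    rw [Prod.Lex.le_iff] at h1
    simp only [ofLex_toLex] at h1
    rcases hb with hb | hb <;> rcases h1 with h1 | h1
    · exact lt_asymm hb h1
    · exact hb.ne' h1.1
    · exact h1.ne' hb.1
    · exact absurd h1.2 (not_le.2 hb.2)

theorem measurableSet_mem_auctionWinners (m D : ℕ) (ξ : ℝ) (s : Fin m) :
    MeasurableSet {c : Fin m → ℝ | s ∈ auctionWinners c D ξ} := by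
  simp only [auctionWinners, Finset.mem_filter, Finset.mem_univ, true_and]
  refine (measurableSet_le (measurable_pi_apply s) measurable_const).inter ?_
  exact measurableSet_card_filter_lt D
    (fun s' (c : Fin m → ℝ) => c s' < c s ∨ (c s' = c s ∧ s' < s)) fun s' =>
      (measurableSet_lt (measurable_pi_apply s') (measurable_pi_apply s)).union
        ((measurableSet_eq_fun (measurable_pi_apply s') (measurable_pi_apply s)).inter
          (MeasurableSet.const _))

theorem measurable_auctionPay (m D : ℕ) (ξ : ℝ) (s : Fin m) :
    Measurable fun c : Fin m → ℝ => auctionPay c D ξ s :=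
  ((Measurable.ite (measurableSet_mem_auctionWinners m D ξ s) (measurable_pi_apply s)
    measurable_const).add (measurable_allocationValue _ _ _)).sub (measurable_allocationValue _ _ _)

theorem auctionPay_nonneg {m : ℕ} {c : Fin m → ℝ} (hc : ∀ s, 0 ≤ c s) (D : ℕ) (ξ : ℝ)
    (s : Fin m) : 0 ≤ auctionPay c D ξ s := by
  refine le_trans ?_ (auction_utility_nonneg c D ξ s)
  split_ifs
  · simpa using hc s
  · simp

theorem auctionPay_le_one {m : ℕ} (c : Fin m → ℝ) (D : ℕ) (s : Fin m) :
    auctionPay c D 1 s ≤ 1 := by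
  by_cases hs : s ∈ auctionWinners c D 1
  · exact auctionPay_le_reserve hs
  · exact (auctionPay_nonpos_of_notMem hs).trans zero_le_one

theorem integrable_auctionPay (m D : ℕ) (s : Fin m) :
    Integrable (fun c : Fin m → ℝ => auctionPay c D 1 s) (unifPi m) := by
  refine Integrable.of_bound (measurable_auctionPay m D 1 s).aestronglyMeasurable 1 ?_
  filter_upwards [ae_unifPi m] with c hc
  rw [Real.norm_of_nonneg (auctionPay_nonneg (fun s => (hc s).1) D 1 s)]
  exact auctionPay_le_one c D s

/-- The expected payments of the auction without effective reserve price. -/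
theorem integral_sum_auctionPay_le (m D : ℕ) :
    ∫ c, ∑ s, auctionPay c D 1 s ∂unifPi m ≤ (D : ℝ) * (D + 1) / (m + 1) := by
  set V : (Fin m → ℝ) → ℝ := fun c => ∑ s, auctionPay c D 1 s
  have hVint : Integrable V (unifPi m) := integrable_finsetSum _ fun s _ =>
    integrable_auctionPay m D s
  set E : Set (ℝ × (Fin m → ℝ)) := {z | (Finset.univ.filter fun t => z.2 t ≤ z.1).card ≤ D}
  have hE : MeasurableSet E := by
    have := measurableSet_card_filter_lt (D + 1) (fun t (z : ℝ × (Fin m → ℝ)) => z.2 t ≤ z.1)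
      fun t => measurableSet_le ((measurable_pi_apply t).comp measurable_snd) measurable_fst
    simpa only [Nat.lt_succ_iff] using this
  -- If `u` is below the average payment `V c / D`, every bidder with cost at most `u` wins, since
  -- `V c ≤ D * c t` for each loser `t`; hence at most `D` costs lie below such `u`. The payment is
  -- thus bounded by the chance that an independent uniform `u` has at most `D` costs not exceeding
  -- it, to which exchangeability applies after Fubini.
  have hpt : ∀ᵐ c ∂unifPi m, V c ≤ D * unif.real ((fun u => (u, c)) ⁻¹' E) := by
    filter_upwards [ae_unifPi m] with c hc
    have hW : ((auctionWinners c D 1).card : ℝ) ≤ D := by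
      exact_mod_cast card_auctionWinners_le c D 1
    have hV0 : 0 ≤ V c := Finset.sum_nonneg fun s _ =>
      auctionPay_nonneg (fun s => (hc s).1) D 1 s
    have h1 : V c ≤ D := by
      have := sum_auctionPay_le (c := c) (D := D) (ξ := 1) fun s hs => auctionPay_le_reserve hs
      linarith
    have h2 : ∀ t, t ∉ auctionWinners c D 1 → V c ≤ D * c t := fun t ht =>
      (sum_auctionPay_le fun s hs => auctionPay_le_loser hs ht).trans
        (mul_le_mul_of_nonneg_right hW (hc t).1)
    rcases Nat.eq_zero_or_pos D with hD | hD
    · rw [hD] at h1 ⊢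
      simpa using h1
    have hD' : (0 : ℝ) < D := by exact_mod_cast hD
    have h3 : Ico 0 (V c / D) ⊆ (fun u => (u, c)) ⁻¹' E := by
      intro u hu
      refine (Finset.card_le_card fun t ht => ?_).trans (card_auctionWinners_le c D 1)
      simp only [Finset.mem_filter, Finset.mem_univ, true_and] at ht
      by_contra h
      have h4 := h2 t h
      have h5 := (lt_div_iff₀ hD').1 hu.2
      nlinarith
    have h4 : unif.real (Ico 0 (V c / D)) = V c / D := by
      rw [measureReal_restrict_apply measurableSet_Ico, inter_eq_left.2]
      · simp [div_nonneg hV0 hD'.le]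
      · exact Ico_subset_Icc_self.trans (Icc_subset_Icc_right ((div_le_one hD').2 h1))
    have h5 := measureReal_mono (μ := unif) h3
    rw [h4, div_le_iff₀ hD'] at h5
    linarith
  have hreal : ∫ c, unif.real ((fun u => (u, c)) ⁻¹' E) ∂unifPi m =
      (unif.prod (unifPi m)).real E := by
    rw [measureReal_def, Measure.prod_apply_symm hE, integral_eq_lintegral_of_nonneg_ae
      (ae_of_all _ fun c => measureReal_nonneg)]
    · congr 1
      exact lintegral_congr fun c => ofReal_measureReal
    · exact (measurable_measure_prodMk_right hE).ennreal_toReal.aestronglyMeasurable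
  have hmeasE : Integrable (fun c => unif.real ((fun u => (u, c)) ⁻¹' E)) (unifPi m) :=
    Integrable.of_bound (measurable_measure_prodMk_right hE).ennreal_toReal.aestronglyMeasurable 1
      (ae_of_all _ fun c => by
        rw [Real.norm_of_nonneg measureReal_nonneg]
        exact measureReal_le_one)
  have h := integral_mono_ae hVint (hmeasE.const_mul (D : ℝ)) hpt
  rw [integral_const_mul, hreal] at h
  have h2 := measure_card_le_le unif m D
  refine h.trans ?_
  rw [mul_div_assoc]
  refine mul_le_mul_of_nonneg_left ?_ D.cast_nonneg
  rw [le_div_iff₀ (by positivity)]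
  linarith

/-- The expected costs of the auction, unmatched loads included. -/
theorem integral_auction_cost_le (m D : ℕ) :
    ∫ c, (2 * ((D : ℝ) - (auctionWinners c D 1).card) + ∑ s, auctionPay c D 1 s) ∂unifPi m ≤
      (D : ℝ) * (D + 1) / (m + 1) := by
  have hVint : Integrable (fun c : Fin m → ℝ => ∑ s, auctionPay c D 1 s) (unifPi m) :=
    integrable_finsetSum _ fun s _ => integrable_auctionPay m D s
  have hcard : ∀ᵐ c ∂unifPi m, (min D m : ℝ) ≤ (auctionWinners c D 1).card := by
    filter_upwards [ae_unifPi m] with c hc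
    exact_mod_cast min_le_card_auctionWinners (fun s => (hc s).2) D
  rcases le_total D m with hDm | hDm
  -- With enough carriers every load is matched, and the costs are payments only.
  · refine le_trans (integral_mono_of_nonneg ?_ hVint ?_) (integral_sum_auctionPay_le m D)
    · filter_upwards [ae_unifPi m] with c hc
      have hW : ((auctionWinners c D 1).card : ℝ) ≤ D := by
        exact_mod_cast card_auctionWinners_le c D 1
      have hV0 : 0 ≤ ∑ s, auctionPay c D 1 s := Finset.sum_nonneg fun s _ =>
        auctionPay_nonneg (fun s => (hc s).1) D 1 s
      simp only [Pi.zero_apply]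
      linarith
    · filter_upwards [hcard] with c hc
      rw [min_eq_left (by exact_mod_cast hDm)] at hc
      linarith
  -- With at least as many loads as carriers all carriers win at a payment of at most 1, so the
  -- costs are at most `2 (D - m) + m`.
  · have hDm' : (m : ℝ) ≤ D := by exact_mod_cast hDm
    have h1 : ∫ c, (2 * ((D : ℝ) - (auctionWinners c D 1).card) + ∑ s, auctionPay c D 1 s)
        ∂unifPi m ≤ ∫ _c, (2 * (D : ℝ) - m) ∂unifPi m := by
      refine integral_mono_of_nonneg ?_ (integrable_const _) ?_
      · filter_upwards [ae_unifPi m] with c hc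
        have hW : ((auctionWinners c D 1).card : ℝ) ≤ D := by
          exact_mod_cast card_auctionWinners_le c D 1
        have hV0 : 0 ≤ ∑ s, auctionPay c D 1 s := Finset.sum_nonneg fun s _ =>
          auctionPay_nonneg (fun s => (hc s).1) D 1 s
        simp only [Pi.zero_apply]
        linarith
      · filter_upwards [hcard] with c hc
        rw [min_eq_right hDm'] at hc
        have := sum_auctionPay_le (c := c) (D := D) (ξ := 1) fun s hs => auctionPay_le_reserve hs
        linarith
    refine h1.trans ?_
    simp only [integral_const, probReal_univ, smul_eq_mul, one_mul]
    rw [le_div_iff₀ (by positivity)]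
    -- After clearing the denominator the difference is `(D - m) (D - m - 1)`, nonnegative because
    -- `D - m` is a natural number.
    rcases hDm.eq_or_lt with rfl | hlt
    · nlinarith
    · have : (m : ℝ) + 1 ≤ D := by exact_mod_cast hlt
      nlinarith

/-! ### Uniform opportunity costs -/

/-- The density of the uniform law on `[0, 1]`. -/
noncomputable def unifDensity : ℝ → ℝ := (Icc 0 1).indicator fun _ => 1

theorem unifDensity_of_mem {c : ℝ} (hc : c ∈ Icc (0 : ℝ) 1) : unifDensity c = 1 :=
  indicator_of_mem hc _

theorem costLaw_unifDensity : costLaw unifDensity = unif := by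
  have h : (fun c => ENNReal.ofReal (unifDensity c)) = (Icc (0 : ℝ) 1).indicator 1 := by
    ext c
    by_cases hc : c ∈ Icc (0 : ℝ) 1 <;> simp [unifDensity, hc]
  rw [costLaw, h, withDensity_indicator_one measurableSet_Icc]

theorem costCdf_unifDensity {c : ℝ} (hc : c ∈ Icc (0 : ℝ) 1) : costCdf unifDensity c = c := by
  rw [costCdf, costLaw_unifDensity, unif_real_Iic hc.1 hc.2]

theorem costQuantile_unifDensity {x : ℝ} (hx : x ∈ Icc (0 : ℝ) 1) :
    costQuantile unifDensity 0 1 x = x := by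
  have h : {c ∈ Icc (0 : ℝ) 1 | x ≤ costCdf unifDensity c} = Icc x 1 := by
    ext c
    simp only [mem_ofPred_eq]
    constructor
    · rintro ⟨h1, h2⟩
      rw [costCdf_unifDensity h1] at h2
      exact ⟨h2, h1.2⟩
    · intro h
      have h1 : c ∈ Icc (0 : ℝ) 1 := ⟨hx.1.trans h.1, h.2⟩
      exact ⟨h1, by rw [costCdf_unifDensity h1]; exact h.1⟩
  rw [costQuantile, h, csInf_Icc hx.2]

theorem virtualCost_unifDensity {c : ℝ} (hc : c ∈ Ioo (0 : ℝ) 1) :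
    virtualCost unifDensity c = 2 * c := by
  have h := Ioo_subset_Icc_self hc
  rw [virtualCost, costCdf_unifDensity h, unifDensity_of_mem h]
  ring

/-- The virtual cost `2c` is below 2 on the whole open interval, so at penalty 2 the supremum is the
endpoint and the reserve excludes no carrier. -/
theorem virtualCostInv_unifDensity_two : virtualCostInv unifDensity 0 1 2 = 1 := by
  have h : {c ∈ Ioo (0 : ℝ) 1 | virtualCost unifDensity c ≤ 2} = Ioo 0 1 := by
    ext c
    simp only [mem_ofPred_eq, and_iff_left_iff_imp]
    intro hc
    rw [virtualCost_unifDensity hc]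
    linarith [hc.2]
  rw [virtualCostInv, h, csSup_Ioo zero_lt_one]

/-- The function is the supremum over `k` of the linear functions `2 k z₁ - k² z₂`, attained at `k =
z₁ / z₂`. -/
theorem convexOn_sq_div :
    ConvexOn ℝ {z : ℝ × ℝ | 0 ≤ z.1 ∧ z.1 ≤ z.2 ∧ 0 < z.2} fun z => z.1 / z.2 * z.1 := by
  refine ⟨fun x hx y hy a b ha hb hab => ?_, fun x hx y hy a b ha hb hab => ?_⟩
  · obtain ⟨h1, h2, h3⟩ := hx
    obtain ⟨h4, h5, h6⟩ := hy
    refine ⟨?_, ?_, ?_⟩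
    · simp only [Prod.fst_add, Prod.smul_fst, smul_eq_mul]; positivity
    · simp only [Prod.fst_add, Prod.smul_fst, Prod.snd_add, Prod.smul_snd, smul_eq_mul]; gcongr
    · simp only [Prod.snd_add, Prod.smul_snd, smul_eq_mul]
      rcases ha.eq_or_lt with rfl | ha
      · have : b = 1 := by linarith
        simpa [this] using h6
      · positivity
  · obtain ⟨h1, h2, h3⟩ := hx
    obtain ⟨h4, h5, h6⟩ := hy
    have key : ∀ w : ℝ × ℝ, 0 < w.2 → ∀ k : ℝ, 2 * k * w.1 - k ^ 2 * w.2 ≤ w.1 / w.2 * w.1 := by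
      intro w hw k
      rw [div_mul_eq_mul_div, le_div_iff₀ hw]
      nlinarith [sq_nonneg (w.1 - k * w.2)]
    set w := a • x + b • y with hw
    have hw2 : 0 < w.2 := by
      simp only [hw, Prod.snd_add, Prod.smul_snd, smul_eq_mul]
      rcases ha.eq_or_lt with rfl | ha
      · have : b = 1 := by linarith
        simpa [this] using h6
      · positivity
    have e1 : w.1 = a * x.1 + b * y.1 := by simp [hw]
    have e2 : w.2 = a * x.2 + b * y.2 := by simp [hw]
    have h7 := mul_le_mul_of_nonneg_left (key x h3 (w.1 / w.2)) ha
    have h8 := mul_le_mul_of_nonneg_left (key y h6 (w.1 / w.2)) hb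
    have h9 : w.1 / w.2 * w.1 = 2 * (w.1 / w.2) * w.1 - (w.1 / w.2) ^ 2 * w.2 := by
      field_simp
      ring
    simp only [smul_eq_mul]
    rw [h9, e1, e2] at *
    linarith

theorem unif_quantile_eqOn :
    EqOn (fun z : ℝ × ℝ => costQuantile unifDensity 0 1 (z.1 / z.2) * z.1)
      (fun z => z.1 / z.2 * z.1) {z : ℝ × ℝ | 0 ≤ z.1 ∧ z.1 ≤ z.2 ∧ 0 < z.2} := by
  rintro z ⟨h1, h2, h3⟩
  simp only
  rw [costQuantile_unifDensity ⟨div_nonneg h1 h3.le, (div_le_one h3).2 h2⟩]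

/-! ### The demand function -/

/-- A demand function with revenue `3 √d - d`. -/
noncomputable def sqDemand (r : ℝ) : ℝ := 9 / (1 + r) ^ 2

theorem sqDemand_strictAntiOn : StrictAntiOn sqDemand (Ici 0) := by
  intro x hx y hy hxy
  have hx' : 0 ≤ x := hx
  unfold sqDemand
  gcongr

theorem sqDemand_pos {r : ℝ} (hr : 0 ≤ r) : 0 < sqDemand r := by
  unfold sqDemand
  positivity

theorem sqDemand_le {r : ℝ} (hr : 0 ≤ r) : sqDemand r ≤ 9 := by
  unfold sqDemand
  rw [div_le_iff₀ (by positivity)]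
  nlinarith

theorem sqDemand_inv {d : ℝ} (h0 : 0 < d) : sqDemand (3 / √d - 1) = d := by
  have h : √d ^ 2 = d := Real.sq_sqrt h0.le
  have h1 : 0 < √d := Real.sqrt_pos.2 h0
  unfold sqDemand
  rw [add_sub_cancel, div_pow, h]
  field_simp
  norm_num

theorem sqDemand_inv_nonneg {d : ℝ} (h0 : 0 < d) (h1 : d ≤ 9) : 0 ≤ 3 / √d - 1 := by
  have h2 : 0 < √d := Real.sqrt_pos.2 h0
  have h3 : √d ≤ 3 := Real.sqrt_le_iff.2 ⟨by norm_num, by linarith⟩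
  rw [sub_nonneg, le_div_iff₀ h2]
  linarith

theorem sqDemand_image : sqDemand '' Ici 0 = Ioc 0 9 := by
  ext d
  constructor
  · rintro ⟨r, hr, rfl⟩
    exact ⟨sqDemand_pos hr, sqDemand_le hr⟩
  · intro h
    exact ⟨3 / √d - 1, sqDemand_inv_nonneg h.1 h.2, sqDemand_inv h.1⟩

theorem invFunOn_sqDemand {d : ℝ} (hd : d ∈ Ioc (0 : ℝ) 9) :
    Function.invFunOn sqDemand (Ici 0) d = 3 / √d - 1 := by
  have hmem : d ∈ sqDemand '' Ici 0 := by rwa [sqDemand_image]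
  refine sqDemand_strictAntiOn.injOn (Function.invFunOn_mem hmem)
    (sqDemand_inv_nonneg hd.1 hd.2) ?_
  rw [Function.invFunOn_eq hmem, sqDemand_inv hd.1]

theorem sqDemand_revenue {d : ℝ} (hd : d ∈ Ioc (0 : ℝ) 9) :
    Function.invFunOn sqDemand (Ici 0) d * d = 3 * √d - d := by
  rw [invFunOn_sqDemand hd]
  have h : √d ^ 2 = d := Real.sq_sqrt hd.1.le
  have h1 : 0 < √d := Real.sqrt_pos.2 hd.1
  rw [sub_mul, div_mul_eq_mul_div, one_mul]
  congr 1
  rw [div_eq_iff h1.ne']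
  nlinarith

/-- The revenue `r d(r)`. -/
theorem mul_sqDemand {r : ℝ} (hr : 0 ≤ r) : r * sqDemand r = 3 * √(sqDemand r) - sqDemand r := by
  have h := sqDemand_revenue (d := sqDemand r) ⟨sqDemand_pos hr, sqDemand_le hr⟩
  rwa [sqDemand_strictAntiOn.injOn.leftInvOn_invFunOn (mem_Ici.2 hr)] at h

/-- The revenue, linearized at the demand rate `1`. -/
theorem mul_sqDemand_sub_le {r : ℝ} (hr : 0 ≤ r) : r * sqDemand r - sqDemand r / 2 ≤ 3 / 2 := by
  rw [mul_sqDemand hr]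
  have h : √(sqDemand r) ^ 2 = sqDemand r := Real.sq_sqrt (sqDemand_pos hr).le
  -- The slack is `3/2 (√d - 1)²`. The slope `1/2` is the marginal cost of a load in the tangent to
  -- the fluid cost.
  nlinarith [sq_nonneg (√(sqDemand r) - 1)]

theorem mul_sqDemand_le {r : ℝ} (hr : 0 ≤ r) : r * sqDemand r ≤ 9 := by
  linarith [mul_sqDemand_sub_le hr, sqDemand_le hr]

/-! ### The problem instance -/

/-- A single lane with uniform costs, arrival rate `4`, and penalty `2`. -/
noncomputable def singleLane : Market 1 where
  arrival _ := 4
  arrival_pos _ := by norm_num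
  demand _ := sqDemand
  demand_nonneg _ _ hr := (sqDemand_pos hr).le
  demand_strictAnti _ := sqDemand_strictAntiOn
  revenue_concave _ := by
    rw [sqDemand_image]
    have h : ConcaveOn ℝ (Ioc (0 : ℝ) 9) fun d => 3 * √d - d := by
      refine ConcaveOn.sub ?_ (convexOn_id (convex_Ioc 0 9))
      exact (Real.strictConcaveOn_sqrt.concaveOn.subset (fun x hx => hx.1.le)
        (convex_Ioc 0 9)).smul (by norm_num : (0 : ℝ) ≤ 3)
    exact h.congr fun d hd => (sqDemand_revenue hd).symm
  penalty _ := 2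
  penalty_nonneg _ := by norm_num
  stay _ := 0
  stay_nonneg _ := le_rfl
  stay_sum_le _ := by simp
  costDensity _ := unifDensity
  costLo _ := 0
  costHi _ := 1
  costLo_nonneg _ := le_rfl
  costLo_lt_costHi _ := zero_lt_one
  costDensity_measurable _ := measurable_const.indicator measurableSet_Icc
  costDensity_pos _ c hc := by
    rw [unifDensity_of_mem (Ioo_subset_Icc_self hc)]
    exact zero_lt_one
  costDensity_zero _ c hc := indicator_of_notMem hc _
  costLaw_prob _ := by
    rw [costLaw_unifDensity]
    infer_instance
  quantile_convex _ := convexOn_sq_div.congr unif_quantile_eqOn.symm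
  quantile_differentiable _ := by
    have h : {z : ℝ × ℝ | 0 < z.1 ∧ z.1 < z.2} ⊆ {z | 0 ≤ z.1 ∧ z.1 ≤ z.2 ∧ 0 < z.2} :=
      fun z hz => ⟨hz.1.le, hz.2.le, hz.1.trans hz.2⟩
    refine DifferentiableOn.congr ?_ (unif_quantile_eqOn.mono h)
    intro z hz
    have hz2 : z.2 ≠ 0 := (hz.1.trans hz.2).ne'
    simp only [div_eq_mul_inv]
    exact ((differentiableAt_fst.mul (differentiableAt_snd.inv hz2)).mul
      differentiableAt_fst).differentiableWithinAt
  virtualCost_strictMono _ x hx y hy hxy := by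
    rw [virtualCost_unifDensity hx, virtualCost_unifDensity hy]
    linarith

/-- The lane of `singleLane`. -/
abbrev lane : Lane 1 := (0, 0)

theorem singleLane_uniformCosts : singleLane.UniformCosts := fun _ =>
  ⟨rfl, rfl, fun _ hc => unifDensity_of_mem hc⟩

theorem lane_eq (e : Lane 1) : e = lane := Subsingleton.elim _ _

theorem sum_lane (f : Lane 1 → ℝ) : ∑ e, f e = f lane := by
  rw [Fintype.sum_eq_single lane fun e he => absurd (lane_eq e) he]

/-! ### The fluid model -/

/-- The optimal solution of the fluid model. -/
def fluidSolution : FluidPoint 1 := ⟨fun _ => 1, fun _ => 1, fun _ => 4⟩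

theorem fluidFeasible_iff (z : FluidPoint 1) :
    singleLane.FluidFeasible z ↔ z.l lane = 4 ∧ z.d lane ∈ Ioc (0 : ℝ) 9 ∧ 0 ≤ z.y lane ∧
      z.y lane ≤ z.d lane ∧ z.y lane ≤ 4 := by
  have h : singleLane.FluidFeasible z ↔ (4 = z.l lane ∧ z.d lane ∈ Ioc (0 : ℝ) 9 ∧
      0 ≤ z.y lane ∧ z.y lane ≤ z.d lane ∧ z.y lane ≤ z.l lane) := by
    rw [← sqDemand_image]
    simp only [Market.FluidFeasible, singleLane, zero_mul, Finset.sum_const_zero, zero_add,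
      Fin.forall_fin_one, Fin.isValue]
  rw [h]
  constructor
  · rintro ⟨h1, h2, h3, h4, h5⟩
    exact ⟨h1.symm, h2, h3, h4, h1 ▸ h5⟩
  · rintro ⟨h1, h2, h3, h4, h5⟩
    exact ⟨h1.symm, h2, h3, h4, h1 ▸ h5⟩

theorem fluidProfit_eq {z : FluidPoint 1} (hz : singleLane.FluidFeasible z) :
    singleLane.fluidProfit z =
      3 * √(z.d lane) - z.d lane - (z.y lane) ^ 2 / 4 - 2 * (z.d lane - z.y lane) := by
  obtain ⟨h1, h2, h3, h4, h5⟩ := (fluidFeasible_iff z).1 hz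
  rw [Market.fluidProfit, sum_lane]
  have e1 : singleLane.shipperPrice lane (z.d lane) * z.d lane = 3 * √(z.d lane) - z.d lane :=
    sqDemand_revenue h2
  have e2 : singleLane.quantile lane (z.y lane / z.l lane) = z.y lane / 4 := by
    rw [h1]
    exact costQuantile_unifDensity ⟨by positivity, by linarith⟩
  rw [e1, e2]
  simp only [singleLane]
  ring

theorem fluidSolution_feasible : singleLane.FluidFeasible fluidSolution := by
  rw [fluidFeasible_iff]
  norm_num [fluidSolution]

theorem fluidProfit_fluidSolution : singleLane.fluidProfit fluidSolution = 7 / 4 := by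
  rw [fluidProfit_eq fluidSolution_feasible]
  norm_num [fluidSolution]

/-- The remaining slack is `(y - 1)² / 4`. Keeping the two explicit deficits yields uniqueness of
the optimum as well as optimality. -/
theorem fluidProfit_le {z : FluidPoint 1} (hz : singleLane.FluidFeasible z) :
    singleLane.fluidProfit z + 3 / 2 * (√(z.d lane) - 1) ^ 2 + 3 / 2 * (z.d lane - z.y lane) ≤
      7 / 4 := by
  rw [fluidProfit_eq hz]
  obtain ⟨h1, h2, h3, h4, h5⟩ := (fluidFeasible_iff z).1 hz
  have h : √(z.d lane) ^ 2 = z.d lane := Real.sq_sqrt h2.1.le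
  nlinarith [sq_nonneg (z.y lane - 1)]

theorem fluidSolution_optimal : singleLane.FluidOptimal fluidSolution := by
  refine ⟨fluidSolution_feasible, fun z hz => ?_⟩
  have h := fluidProfit_le hz
  obtain ⟨h1, h2, h3, h4, h5⟩ := (fluidFeasible_iff z).1 hz
  rw [fluidProfit_fluidSolution]
  nlinarith [sq_nonneg (√(z.d lane) - 1)]

theorem eq_fluidSolution {z : FluidPoint 1} (hz : singleLane.FluidOptimal z) :
    z = fluidSolution := by
  have h := fluidProfit_le hz.1
  have h0 := hz.2 _ fluidSolution_feasible
  rw [fluidProfit_fluidSolution] at h0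
  obtain ⟨h1, h2, h3, h4, h5⟩ := (fluidFeasible_iff z).1 hz.1
  have h6 : √(z.d lane) = 1 := by
    have : (√(z.d lane) - 1) ^ 2 = 0 :=
      le_antisymm (by nlinarith) (sq_nonneg _)
    linarith [pow_eq_zero_iff (two_ne_zero) |>.1 this]
  have hd : z.d lane = 1 := Real.sqrt_eq_one.1 h6
  have hy : z.y lane = 1 := by nlinarith [sq_nonneg (√(z.d lane) - 1)]
  obtain ⟨d, y, l⟩ := z
  simp only [fluidSolution, FluidPoint.mk.injEq]
  refine ⟨funext fun e => ?_, funext fun e => ?_, funext fun e => ?_⟩ <;> rw [lane_eq e] <;>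
    assumption

theorem shipperPrice_fluidSolution :
    singleLane.fluidShipperPrice fluidSolution = fun _ => 2 := by
  ext e
  have h := invFunOn_sqDemand (d := 1) ⟨one_pos, by norm_num⟩
  rw [Real.sqrt_one] at h
  exact h.trans (by norm_num)

theorem carrierPrice_fluidSolution :
    singleLane.fluidCarrierPrice fluidSolution = fun _ => 1 / 4 := by
  ext e
  exact costQuantile_unifDensity (x := 1 / 4) ⟨by norm_num, by norm_num⟩

theorem reserve_fluidSolution : singleLane.reserve fluidSolution = fun _ => 1 := by
  ext e
  rw [Market.reserve, carrierPrice_fluidSolution]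
  have : virtualCostInv (singleLane.costDensity e) (singleLane.costLo e) (singleLane.costHi e)
      (singleLane.penalty e) = 1 := virtualCostInv_unifDensity_two
  rw [this]
  norm_num

theorem sqDemand_two : sqDemand 2 = 1 := by
  norm_num [sqDemand]

/-- The maps in question are projections and resamplings, which are not embeddings, so regularity is
asked of `g` instead. -/
theorem _root_.MeasureTheory.MeasurePreserving.integral_comp_of_aestronglyMeasurable
    {α β : Type*} [MeasurableSpace α] [MeasurableSpace β] {μ : Measure α} {ν : Measure β}
    {f : α → β} (hf : MeasurePreserving f μ ν) {g : β → ℝ} (hg : AEStronglyMeasurable g ν) :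
    ∫ x, g (f x) ∂μ = ∫ y, g y ∂ν := by
  rw [← hf.map_eq] at hg ⊢
  rw [integral_map hf.measurable.aemeasurable hg]

/-! ### The law of the bids -/

theorem bidLaw_eq (x : State 1) :
    singleLane.bidLaw x = (Measure.pi fun e => unifPi (x.1 e)).prod volume := by
  have h : ∀ e, costLaw (singleLane.costDensity e) = unif := fun _ => costLaw_unifDensity
  simp only [Market.bidLaw, h]

instance (x : State 1) : IsProbabilityMeasure (singleLane.bidLaw x) := by
  rw [bidLaw_eq]
  infer_instance

theorem measurePreserving_bids (x : State 1) (e : Lane 1) :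
    MeasurePreserving (fun z : Bids x × unitInterval => z.1 e) (singleLane.bidLaw x)
      (unifPi (x.1 e)) := by
  rw [bidLaw_eq]
  exact (measurePreserving_eval (fun e => unifPi (x.1 e)) e).comp measurePreserving_fst

theorem ae_bidLaw (x : State 1) :
    ∀ᵐ z ∂singleLane.bidLaw x, ∀ e s, z.1 e s ∈ Icc (0 : ℝ) 1 :=
  ae_all_iff.2 fun e => (measurePreserving_bids x e).quasiMeasurePreserving.ae (ae_unifPi _)

theorem measurable_setBid {x : State 1} (e : Lane 1) (s : Fin (x.1 e)) (v : ℝ) :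
    Measurable fun z : Bids x × unitInterval => (setBid z.1 e s v, z.2) := by
  refine Measurable.prodMk (measurable_pi_lambda _ fun e' => measurable_pi_lambda _ fun s' => ?_)
    measurable_snd
  by_cases h : e' = e
  · subst h
    simp only [setBid, Function.update_self]
    by_cases hs : s' = s
    · subst hs
      simp
    · simpa only [Function.update_of_ne hs] using measurable_bid e' s'
  · simpa only [setBid, Function.update_of_ne h] using measurable_bid e' s'

theorem setBid_mem {x : State 1} {c : Bids x} (hc : ∀ e s, c e s ∈ Icc (0 : ℝ) 1) (e : Lane 1)
    (s : Fin (x.1 e)) {v : ℝ} (hv : v ∈ Icc (0 : ℝ) 1) :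
    ∀ e' s', setBid c e s v e' s' ∈ Icc (0 : ℝ) 1 := by
  intro e' s'
  by_cases h : e' = e
  · subst h
    by_cases hs : s' = s
    · subst hs
      simpa [setBid] using hv
    · simpa [setBid, hs] using hc e' s'
  · simpa [setBid, h] using hc e' s'

theorem finitePayments_of_bounded (m : Mechanism 1) (C : State 1 → ℝ)
    (hC : ∀ x c u e s, (∀ e s, c e s ∈ Icc (0 : ℝ) 1) → |m.pay x c u e s| ≤ C x) :
    singleLane.FinitePayments m := by
  intro x e s
  refine ⟨Integrable.of_bound (m.measurable_pay x e s).aestronglyMeasurable (C x) ?_,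
    fun v hv => Integrable.of_bound ((m.measurable_pay x e s).comp
      (measurable_setBid e s v)).aestronglyMeasurable (C x) ?_⟩
  · filter_upwards [ae_bidLaw x] with z hz using hC _ _ _ _ _ hz
  · filter_upwards [ae_bidLaw x] with z hz using hC _ _ _ _ _ (setBid_mem hz e s hv)

/-- Resampling the bid of one carrier preserves the law of the bids. -/
theorem measurePreserving_setBid (x : State 1) (e : Lane 1) (s : Fin (x.1 e)) :
    MeasurePreserving (fun w : (Bids x × unitInterval) × ℝ => (setBid w.1.1 e s w.2, w.1.2))
      ((singleLane.bidLaw x).prod unif) (singleLane.bidLaw x) := by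
  rw [bidLaw_eq]
  set P : Measure (Bids x) := Measure.pi fun e => unifPi (x.1 e)
  have h1 : MeasurePreserving (fun w : (Fin (x.1 e) → ℝ) × ℝ => Function.update w.1 s w.2)
      ((unifPi (x.1 e)).prod unif) (unifPi (x.1 e)) :=
    measurePreserving_update (fun _ => unif) unif s Prod.snd measurePreserving_snd
  -- The new bids of lane `e` depend on its old ones, since only the coordinate `s` is replaced; two
  -- nested resamplings give the claim.
  have h2 : MeasurePreserving (fun w : Bids x × ℝ => setBid w.1 e s w.2) (P.prod unif) P :=
    measurePreserving_update (fun e => unifPi (x.1 e)) unif e _ h1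
  have h3 := measurePreserving_prodAssoc P (volume : Measure unitInterval) unif
  have h4 := (MeasurePreserving.id P).prod
    (Measure.measurePreserving_swap (μ := (volume : Measure unitInterval)) (ν := unif))
  have h5 := (measurePreserving_prodAssoc P unif (volume : Measure unitInterval)).symm
  have h6 := h2.prod (MeasurePreserving.id (volume : Measure unitInterval))
  exact h6.comp (h5.comp (h4.comp h3))

/-! ### The law of the states -/

theorem measurable_winners_card (m : Mechanism 1) (x : State 1) :
    Measurable fun z : Bids x × unitInterval => fun e => (m.winners x z.1 z.2 e).card :=
  measurable_pi_lambda _ fun e =>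
    measurable_card_filter (fun z : Bids x × unitInterval => m.winners x z.1 z.2 e)
      (m.measurable_winners x e)

theorem multinomialLaw_zero {n : ℕ} (k : ℕ) :
    Market.multinomialLaw (fun _ : Fin n => 0) k = Measure.dirac 0 := by
  induction k with
  | zero => rfl
  | succ k ih =>
    rw [Market.multinomialLaw, ih, Measure.dirac_bind .of_discrete]
    simp

theorem pi_dirac_zero {ι : Type*} [Fintype ι] {X : ι → Type*} [∀ i, MeasurableSpace (X i)]
    [∀ i, Zero (X i)] :
    (Measure.pi fun i => Measure.dirac (0 : X i)) = Measure.dirac (0 : ∀ i, X i) := by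
  refine Measure.pi_eq fun s hs => ?_
  rw [Measure.dirac_apply' _ (MeasurableSet.univ_pi hs)]
  simp only [Measure.dirac_apply' _ (hs _)]
  by_cases h : ∀ i, (0 : X i) ∈ s i
  · rw [indicator_of_mem (by simpa [Set.mem_pi] using h)]
    simp [h]
  · rw [indicator_of_notMem (by simpa [Set.mem_pi] using h)]
    obtain ⟨i, hi⟩ := not_forall.1 h
    exact (Finset.prod_eq_zero (Finset.mem_univ i) (by simp [hi])).symm

theorem stayLaw_singleLane (y : Lane 1 → ℕ) : singleLane.stayLaw y = Measure.dirac 0 := by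
  have h : ∀ i : Fin 1, Market.multinomialLaw (fun j => singleLane.stay (i, j))
      (∑ k, y (k, i)) = Measure.dirac 0 := fun i => multinomialLaw_zero _
  simp only [Market.stayLaw, h]
  rw [pi_dirac_zero, Measure.map_dirac' .of_discrete]
  rfl

/-- The carriers and loads on the lane. -/
def obs (x : State 1) : ℕ × ℕ := (x.1 lane, x.2 lane)

/-- The law of carriers and loads when the mean number of loads is `d`. -/
noncomputable abbrev poissonPair (θ : ℕ) (d : ℝ) : Measure (ℕ × ℕ) :=
  (poissonMeasure (θ * 4 : ℝ).toNNReal).prod (poissonMeasure d.toNNReal)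

/-- The allocation enters the transition only through returning carriers, of whom there are none.
Hence the carrier mechanism influences only the profit of its own period, and the shipper price is
the sole link to the next one. -/
theorem nextLaw_eq (θ : ℕ) (π : Policy 1) (x : State 1) :
    singleLane.nextLaw θ π x = (Measure.pi fun _ => poissonMeasure (θ * 4 : ℝ).toNNReal).prod
      (Measure.pi fun e => poissonMeasure (θ * sqDemand (π.price x e)).toNNReal) := by
  have h1 : IsProbabilityMeasure (singleLane.transportedLaw π.mech x) :=
    Measure.isProbabilityMeasure_map (measurable_winners_card π.mech x).aemeasurable
  have h2 : (singleLane.transportedLaw π.mech x).bind singleLane.stayLaw = Measure.dirac 0 := by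
    rw [show singleLane.stayLaw = fun _ => Measure.dirac 0 from funext stayLaw_singleLane,
      Measure.bind_const]
    simp
  have h3 : singleLane.nextLaw θ π x = Measure.map (fun w => (w.1 + w.2.1, w.2.2))
      ((Measure.dirac 0).prod ((Measure.pi fun _ => poissonMeasure (θ * 4 : ℝ).toNNReal).prod
      (Measure.pi fun e => poissonMeasure (θ * sqDemand (π.price x e)).toNNReal))) := by
    rw [← h2]
    rfl
  rw [h3, Measure.dirac_prod, Measure.map_map .of_discrete .of_discrete]
  have h4 : ((fun w : (Lane 1 → ℕ) × (Lane 1 → ℕ) × (Lane 1 → ℕ) => (w.1 + w.2.1, w.2.2)) ∘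
      Prod.mk 0) = id := by
    ext w <;> simp
  rw [h4, Measure.map_id]

instance (θ : ℕ) (π : Policy 1) (x : State 1) :
    IsProbabilityMeasure (singleLane.nextLaw θ π x) := by
  rw [nextLaw_eq]
  infer_instance

theorem measurePreserving_obs (θ : ℕ) (π : Policy 1) (x : State 1) :
    MeasurePreserving obs (singleLane.nextLaw θ π x)
      (poissonPair θ (θ * sqDemand (π.price x lane))) := by
  rw [nextLaw_eq]
  exact (measurePreserving_eval (fun _ : Lane 1 => poissonMeasure (θ * 4 : ℝ).toNNReal) lane).prod
    (measurePreserving_eval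
      (fun e : Lane 1 => poissonMeasure (θ * sqDemand (π.price x e)).toNNReal) lane)

instance (θ : ℕ) (π : Policy 1) (x₀ : State 1) (t : ℕ) :
    IsProbabilityMeasure (singleLane.stateLaw θ π x₀ t) := by
  induction t with
  | zero => exact Measure.dirac.isProbabilityMeasure
  | succ t ih =>
    exact isProbabilityMeasure_bind Measurable.of_discrete.aemeasurable
      (ae_of_all _ fun x => inferInstance)

/-- With static prices the states of all periods but the first have the same law. -/
theorem stateLaw_succ_of_static {θ : ℕ} {π : Policy 1} {r : Lane 1 → ℝ}
    (hr : ∀ x, π.price x = r) (x₀ y : State 1) (t : ℕ) :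
    singleLane.stateLaw θ π x₀ (t + 1) = singleLane.nextLaw θ π y := by
  have h : singleLane.nextLaw θ π = fun _ => singleLane.nextLaw θ π y := by
    ext x : 1
    rw [nextLaw_eq, nextLaw_eq, hr, hr]
  rw [Market.stateLaw, h, Measure.bind_const]
  simp

/-- From the second period on the expected profits are constant, so their Cesàro means converge to
that constant from any initial state. -/
theorem hasAverageProfit_of_static {θ : ℕ} {π : Policy 1} {r : Lane 1 → ℝ}
    (hr : ∀ x, π.price x = r) (hfin : singleLane.FinitePayments π.mech)
    (hint : Integrable (singleLane.periodProfit θ π) (singleLane.nextLaw θ π 0)) :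
    singleLane.HasAverageProfit θ π
      (∫ x, singleLane.periodProfit θ π x ∂singleLane.nextLaw θ π 0) := by
  refine ⟨hfin, fun x₀ => ⟨fun t => ?_, ?_⟩⟩
  · cases t with
    | zero => exact integrable_dirac (by simp)
    | succ t => rwa [stateLaw_succ_of_static hr x₀ 0 t]
  · set a := ∫ x, singleLane.periodProfit θ π x ∂singleLane.nextLaw θ π 0
    have h : Tendsto (fun t => ∫ x, singleLane.periodProfit θ π x
        ∂singleLane.stateLaw θ π x₀ t) atTop (𝓝 a) := by
      rw [← tendsto_add_atTop_iff_nat 1]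
      simp only [stateLaw_succ_of_static hr x₀ 0]
      exact tendsto_const_nhds
    refine h.cesaro.congr fun T => ?_
    rw [div_eq_inv_mul]

/-! ### Profits -/

/-- The expected revenue of a period. -/
noncomputable def revenue (θ : ℕ) (π : Policy 1) (x : State 1) : ℝ :=
  π.price x lane * (θ * sqDemand (π.price x lane))

theorem revenue_nonneg (θ : ℕ) (π : Policy 1) (x : State 1) : 0 ≤ revenue θ π x := by
  have h := π.price_nonneg x lane
  have := (sqDemand_pos h).le
  unfold revenue
  positivity

theorem revenue_le (θ : ℕ) (π : Policy 1) (x : State 1) : revenue θ π x ≤ θ * 9 := by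
  have h := mul_sqDemand_le (π.price_nonneg x lane)
  unfold revenue
  nlinarith [θ.cast_nonneg (α := ℝ)]

theorem integrable_winners_card (m : Mechanism 1) (x : State 1) (e : Lane 1) :
    Integrable (fun z : Bids x × unitInterval => ((m.winners x z.1 z.2 e).card : ℝ))
      (singleLane.bidLaw x) := by
  refine Integrable.of_bound (measurable_from_top.comp
    ((measurable_pi_apply e).comp (measurable_winners_card m x))).aestronglyMeasurable (x.2 e)
    (ae_of_all _ fun z => ?_)
  rw [Real.norm_of_nonneg (by positivity)]
  exact_mod_cast m.card_winners_le x z.1 z.2 e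

theorem periodProfit_eq {θ : ℕ} {π : Policy 1} (hfin : singleLane.FinitePayments π.mech)
    (x : State 1) :
    singleLane.periodProfit θ π x = revenue θ π x -
      ∫ z, (2 * ((x.2 lane : ℝ) - (π.mech.winners x z.1 z.2 lane).card) +
        ∑ s, π.mech.pay x z.1 z.2 lane s) ∂singleLane.bidLaw x := by
  have h1 : ∀ z : Bids x × unitInterval,
      ∑ e, (π.price x e * (θ * singleLane.demand e (π.price x e))
        - singleLane.penalty e * ((x.2 e : ℝ) - ((π.mech.winners x z.1 z.2 e).card : ℝ))
        - ∑ s, π.mech.pay x z.1 z.2 e s) = revenue θ π x -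
      (2 * ((x.2 lane : ℝ) - (π.mech.winners x z.1 z.2 lane).card) +
        ∑ s, π.mech.pay x z.1 z.2 lane s) := by
    intro z
    rw [sum_lane, ← sub_sub]
    rfl
  simp only [Market.periodProfit, h1]
  rw [integral_sub (integrable_const _)]
  · simp
  · exact (((integrable_const _).sub (integrable_winners_card π.mech x lane)).const_mul 2).add
      (integrable_finsetSum _ fun s _ => (hfin x lane s).1)

/-- The expected costs of posting the price `p` to `m` carriers when there are `D` loads. -/
noncomputable def postedCost (m D : ℕ) (p : ℝ) : ℝ :=
  ∫ c, (2 * ((D : ℝ) - (postedWinners c D p).card) + p * (postedWinners c D p).card) ∂unifPi m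

/-- The expected costs of the auction with `m` carriers and `D` loads. -/
noncomputable def auctionCost (m D : ℕ) : ℝ :=
  ∫ c, (2 * ((D : ℝ) - (auctionWinners c D 1).card) + ∑ s, auctionPay c D 1 s) ∂unifPi m

theorem finitePayments_postedPrice (p : State 1 → Lane 1 → ℝ) :
    singleLane.FinitePayments (postedPrice p) := by
  refine finitePayments_of_bounded _ (fun x => |p x lane|) fun x c u e s _ => ?_
  rw [← lane_eq e]
  simp only [postedPrice]
  split_ifs <;> simp

theorem periodProfit_of_posted {θ : ℕ} {π : Policy 1} {p : State 1 → Lane 1 → ℝ}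
    (hπ : π.mech = postedPrice p) (x : State 1) :
    singleLane.periodProfit θ π x =
      revenue θ π x - postedCost (x.1 lane) (x.2 lane) (p x lane) := by
  rw [periodProfit_eq (by rw [hπ]; exact finitePayments_postedPrice p), hπ]
  congr 1
  have hm := measurable_card_postedWinners (x.1 lane) (x.2 lane) (p x lane)
  have hm' : Measurable fun c : Fin (x.1 lane) → ℝ =>
      ((postedWinners c (x.2 lane) (p x lane)).card : ℝ) := measurable_from_top.comp hm
  have hg : Measurable fun c : Fin (x.1 lane) → ℝ =>
      2 * ((x.2 lane : ℝ) - (postedWinners c (x.2 lane) (p x lane)).card) +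
        p x lane * (postedWinners c (x.2 lane) (p x lane)).card :=
    ((hm'.const_sub _).const_mul 2).add (hm'.const_mul _)
  refine Eq.trans ?_ ((measurePreserving_bids x lane).integral_comp_of_aestronglyMeasurable
    hg.aestronglyMeasurable)
  refine integral_congr_ae (ae_of_all _ fun z => ?_)
  simp [postedPrice, mul_comm]

theorem auctionPay_mem {m : ℕ} {c : Fin m → ℝ} (hc : ∀ s, c s ∈ Icc (0 : ℝ) 1) (D : ℕ)
    (s : Fin m) : |auctionPay c D 1 s| ≤ 1 := by
  rw [abs_of_nonneg (auctionPay_nonneg (fun s => (hc s).1) D 1 s)]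
  exact auctionPay_le_one c D s

/-- The uniform price auction with reserve price `1`. -/
noncomputable abbrev unitAuction : Mechanism 1 := uniformPriceAuction fun _ => 1

theorem finitePayments_unitAuction : singleLane.FinitePayments unitAuction :=
  finitePayments_of_bounded _ (fun _ => 1) fun _ _ _ e s hc => auctionPay_mem (hc e) _ s

theorem periodProfit_of_unitAuction {θ : ℕ} {π : Policy 1} (hπ : π.mech = unitAuction)
    (x : State 1) :
    singleLane.periodProfit θ π x = revenue θ π x - auctionCost (x.1 lane) (x.2 lane) := by
  rw [periodProfit_eq (by rw [hπ]; exact finitePayments_unitAuction), hπ]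
  congr 1
  have hm : Measurable fun c : Fin (x.1 lane) → ℝ =>
      ((auctionWinners c (x.2 lane) 1).card : ℝ) :=
    measurable_from_top.comp (measurable_card_filter _ (measurableSet_mem_auctionWinners _ _ 1))
  have hg : Measurable fun c : Fin (x.1 lane) → ℝ =>
      2 * ((x.2 lane : ℝ) - (auctionWinners c (x.2 lane) 1).card) +
        ∑ s, auctionPay c (x.2 lane) 1 s :=
    ((hm.const_sub _).const_mul 2).add
      (Finset.measurable_sum _ fun s _ => measurable_auctionPay _ _ 1 s)
  exact (measurePreserving_bids x lane).integral_comp_of_aestronglyMeasurable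
    hg.aestronglyMeasurable

/-! ### Upper bound for posted prices -/

/-- A lower bound for the costs of posting any price. -/
noncomputable def costBound (w : ℕ × ℕ) : ℝ :=
  max 0 ((w.2 : ℝ) / 2 - w.1 / 16 + postedLoss * √(w.1 : ℝ))

theorem integrable_linearCost (θ : ℕ) (d : ℝ) :
    Integrable (fun w : ℕ × ℕ => (w.2 : ℝ) / 2 - w.1 / 16 + postedLoss * √(w.1 : ℝ))
      (poissonPair θ d) :=
  ((((integrable_poisson_id _).comp_snd _).div_const 2).sub
    (((integrable_poisson_id _).comp_fst _).div_const 16)).add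
    (((integrable_poisson_sqrt _).comp_fst _).const_mul _)

theorem integrable_costBound (θ : ℕ) (d : ℝ) : Integrable costBound (poissonPair θ d) :=
  (integrable_const (0 : ℝ)).sup (integrable_linearCost θ d)

theorem le_integral_costBound {θ : ℕ} (hθ : 1 ≤ θ) {d : ℝ} (hd : 0 ≤ d) :
    d / 2 - θ / 4 + postedLoss * √(θ : ℝ) ≤ ∫ w, costBound w ∂poissonPair θ d := by
  have hθ1 : (1 : ℝ) ≤ θ := by exact_mod_cast hθ
  have h4 : ((θ * 4 : ℝ).toNNReal : ℝ) = θ * 4 := Real.coe_toNNReal _ (by positivity)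
  -- The arrival rate 4 compensates the factor `1/2` in the bound for the mean square root: `√(4θ) /
  -- 2 = √θ`.
  have hsq : √(θ : ℝ) ≤ ∫ n : ℕ, √(n : ℝ) ∂poissonMeasure (θ * 4 : ℝ).toNNReal := by
    have h := le_integral_poisson_sqrt (θ * 4 : ℝ).toNNReal
      (by rw [← NNReal.coe_le_coe, h4, NNReal.coe_one]; linarith)
    have h2 : √(4 : ℝ) = 2 := by
      rw [show (4 : ℝ) = 2 ^ 2 by norm_num]
      exact Real.sqrt_sq (by norm_num)
    rw [h4, Real.sqrt_mul (by positivity), h2] at h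
    linarith
  have h1 : Integrable (fun w : ℕ × ℕ => (w.2 : ℝ) / 2) (poissonPair θ d) :=
    ((integrable_poisson_id _).comp_snd _).div_const 2
  have h2 : Integrable (fun w : ℕ × ℕ => (w.1 : ℝ) / 16) (poissonPair θ d) :=
    ((integrable_poisson_id _).comp_fst _).div_const 16
  have h3 : Integrable (fun w : ℕ × ℕ => postedLoss * √(w.1 : ℝ)) (poissonPair θ d) :=
    ((integrable_poisson_sqrt _).comp_fst _).const_mul _
  have h12 : Integrable (fun w : ℕ × ℕ => (w.2 : ℝ) / 2 - w.1 / 16) (poissonPair θ d) := h1.sub h2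
  calc d / 2 - θ / 4 + postedLoss * √(θ : ℝ)
      ≤ d / 2 - θ * 4 / 16 +
        postedLoss * ∫ n : ℕ, √(n : ℝ) ∂poissonMeasure (θ * 4 : ℝ).toNNReal := by
        have := mul_le_mul_of_nonneg_left hsq postedLoss_pos.le
        linarith
    _ = ∫ w : ℕ × ℕ, ((w.2 : ℝ) / 2 - w.1 / 16 + postedLoss * √(w.1 : ℝ)) ∂poissonPair θ d := by
        rw [integral_add h12 h3, integral_sub h1 h2,
          integral_fun_snd (μ := poissonMeasure (θ * 4 : ℝ).toNNReal)
            (ν := poissonMeasure d.toNNReal) (fun n : ℕ => (n : ℝ) / 2),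
          integral_fun_fst (μ := poissonMeasure (θ * 4 : ℝ).toNNReal)
            (ν := poissonMeasure d.toNNReal) (fun n : ℕ => (n : ℝ) / 16),
          integral_fun_fst (μ := poissonMeasure (θ * 4 : ℝ).toNNReal)
            (ν := poissonMeasure d.toNNReal) (fun n : ℕ => postedLoss * √(n : ℝ)),
          integral_div, integral_div, integral_const_mul, integral_poisson_id,
          integral_poisson_id, h4, Real.coe_toNNReal _ hd]
        simp
    _ ≤ _ := integral_mono (integrable_linearCost θ d) (integrable_costBound θ d)
        fun w => le_max_right _ _

theorem costBound_le_postedCost (w : ℕ × ℕ) (p : ℝ) : costBound w ≤ postedCost w.1 w.2 p :=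
  le_integral_posted_cost _ _ _

/-- A lower bound for the mean of a nonnegative function after a transition. -/
theorem integral_le_integral_bind {α β : Type*} [MeasurableSpace α] [MeasurableSpace β]
    {μ : Measure α} {κ : α → Measure β} (hκ : Measurable κ) {f : α → ℝ} {g : β → ℝ}
    (hf0 : 0 ≤ f) (hg0 : 0 ≤ g) (hf : Integrable f μ) (hg : Integrable g (μ.bind κ))
    (hκg : ∀ x, Integrable g (κ x)) (h : ∀ x, f x ≤ ∫ y, g y ∂κ x) :
    ∫ x, f x ∂μ ≤ ∫ y, g y ∂μ.bind κ := by
  -- Both functions being nonnegative, the comparison takes place between Lebesgue integrals, where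
  -- the integral over `bind` is iterated without further integrability.
  rw [← ENNReal.ofReal_le_ofReal_iff (integral_nonneg hg0),
    ofReal_integral_eq_lintegral_ofReal hf (ae_of_all _ hf0),
    ofReal_integral_eq_lintegral_ofReal hg (ae_of_all _ hg0),
    Measure.lintegral_bind hκ.aemeasurable hg.aestronglyMeasurable.aemeasurable.ennreal_ofReal]
  refine lintegral_mono fun x => ?_
  rw [← ofReal_integral_eq_lintegral_ofReal (hκg x) (ae_of_all _ hg0)]
  exact ENNReal.ofReal_le_ofReal (h x)

/-- If the revenue of each period exceeds the costs of the next one by at most `B`, the average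
profit is at most `B`. -/
theorem average_le_of_shifted {a ρ k : ℕ → ℝ} {B C γ : ℝ} (ha : ∀ t, a t ≤ ρ t - k t)
    (hk : 0 ≤ k 0) (hρ : ∀ t, ρ t ≤ C) (hB : ∀ t, ρ t - k (t + 1) ≤ B)
    (hγ : Tendsto (fun T : ℕ => (∑ t ∈ Finset.range T, a t) / T) atTop (𝓝 γ)) : γ ≤ B := by
  have hsum : ∀ T : ℕ, ∑ t ∈ Finset.range (T + 1), a t ≤ T * B + ρ T := by
    intro T
    induction T with
    | zero =>
      have := ha 0
      simp only [zero_add, Finset.range_one, Finset.sum_singleton, CharP.cast_eq_zero, zero_mul]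
      linarith
    | succ T ih =>
      rw [Finset.sum_range_succ]
      have h1 := ha (T + 1)
      have h2 := hB T
      push_cast
      linarith
  -- Only the last revenue is left without a matching cost; it is at most `C` and vanishes on
  -- average.
  have hlim : Tendsto (fun T : ℕ => B + (C - B) / ((T : ℝ) + 1)) atTop (𝓝 (B + 0)) :=
    tendsto_const_nhds.add (tendsto_const_nhds.div_atTop
      (tendsto_natCast_atTop_atTop.atTop_add tendsto_const_nhds))
  rw [add_zero] at hlim
  refine le_of_tendsto_of_tendsto' ((tendsto_add_atTop_iff_nat 1).2 hγ) hlim fun T => ?_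
  have hT : (0 : ℝ) < (T : ℝ) + 1 := by positivity
  push_cast
  rw [div_le_iff₀ hT, add_mul, div_mul_cancel₀ _ hT.ne']
  have h1 := hsum T
  have h2 := hρ T
  linarith

theorem integrable_revenue (θ : ℕ) (π : Policy 1) (μ : Measure (State 1)) [IsFiniteMeasure μ] :
    Integrable (revenue θ π) μ :=
  Integrable.of_bound .of_discrete (θ * 9) (ae_of_all _ fun x => by
    rw [Real.norm_of_nonneg (revenue_nonneg θ π x)]
    exact revenue_le θ π x)

/-- All posted price policies lose at least a term of order `√θ` compared to the fluid model. -/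
theorem posted_average_le {θ : ℕ} (hθ : 1 ≤ θ) {π : Policy 1} {p : State 1 → Lane 1 → ℝ}
    (hπ : π.mech = postedPrice p) {γ : ℝ} (hγ : singleLane.HasAverageProfit θ π γ) :
    γ ≤ θ * (7 / 4) - postedLoss * √(θ : ℝ) := by
  obtain ⟨-, h⟩ := hγ
  obtain ⟨hint, hlim⟩ := h 0
  set μ := singleLane.stateLaw θ π 0 with hμ
  have hprofit : ∀ x, singleLane.periodProfit θ π x ≤ revenue θ π x - costBound (obs x) := by
    intro x
    rw [periodProfit_of_posted hπ]
    have := costBound_le_postedCost (obs x) (p x lane)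
    simp only [obs] at this ⊢
    linarith
  have hcb0 : ∀ w, 0 ≤ costBound w := fun w => le_max_left _ _
  have hcost : ∀ t, Integrable (fun x => costBound (obs x)) (μ t) := by
    intro t
    -- Posted prices may be unbounded over the states, so integrability of the cost bound comes from
    -- that of the profit: it lies between 0 and revenue minus profit.
    refine Integrable.mono' ((integrable_revenue θ π _).sub (hint t)) .of_discrete
      (ae_of_all _ fun x => ?_)
    rw [Real.norm_of_nonneg (hcb0 _)]
    have := hprofit x
    simp only [Pi.sub_apply]
    linarith
  have hθ0 : (0 : ℝ) ≤ θ := θ.cast_nonneg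
  have hd : ∀ x, 0 ≤ θ * sqDemand (π.price x lane) := fun x =>
    mul_nonneg hθ0 (sqDemand_pos (π.price_nonneg x lane)).le
  have hnext : ∀ x, θ * sqDemand (π.price x lane) / 2 - θ / 4 + postedLoss * √(θ : ℝ) ≤
      ∫ y, costBound (obs y) ∂singleLane.nextLaw θ π x := by
    intro x
    rw [(measurePreserving_obs θ π x).integral_comp_of_aestronglyMeasurable .of_discrete]
    exact le_integral_costBound hθ (hd x)
  refine average_le_of_shifted (C := θ * 9) (ρ := fun t => ∫ x, revenue θ π x ∂μ t)
    (k := fun t => ∫ x, costBound (obs x) ∂μ t) (fun t => ?_) ?_ (fun t => ?_) (fun t => ?_) hlim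
  · rw [← integral_sub (integrable_revenue θ π _) (hcost t)]
    exact integral_mono (hint t) ((integrable_revenue θ π _).sub (hcost t)) hprofit
  · exact integral_nonneg fun x => hcb0 _
  · calc ∫ x, revenue θ π x ∂μ t ≤ ∫ _x, (θ * 9 : ℝ) ∂μ t :=
          integral_mono (integrable_revenue θ π _) (integrable_const _) (revenue_le θ π)
      _ = θ * 9 := by simp [hμ]
  · set B := θ * (7 / 4 : ℝ) - postedLoss * √(θ : ℝ)
    -- The positive part makes the surplus over `B` eligible for the comparison along a transition;
    -- the cost bound of the next period is nonnegative and so dominates it too.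
    let f : State 1 → ℝ := fun x => max 0 (revenue θ π x - B)
    have hfint : Integrable f (μ t) :=
      (integrable_const (0 : ℝ)).sup ((integrable_revenue θ π _).sub (integrable_const B))
    have hf : ∀ x, f x ≤ ∫ y, costBound (obs y) ∂singleLane.nextLaw θ π x := by
      intro x
      refine max_le (integral_nonneg fun y => hcb0 _) (le_trans ?_ (hnext x))
      have h1 := mul_le_mul_of_nonneg_left (mul_sqDemand_sub_le (π.price_nonneg x lane)) hθ0
      simp only [B, revenue]
      linarith
    have h1 : ∫ x, f x ∂μ t ≤ ∫ x, costBound (obs x) ∂μ (t + 1) := by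
      refine integral_le_integral_bind .of_discrete (fun x => le_max_left _ _)
        (fun x => hcb0 _) hfint (hcost (t + 1)) (fun x => ?_) hf
      exact ((measurePreserving_obs θ π x).integrable_comp .of_discrete).2
        (integrable_costBound _ _)
    have h2 : ∫ x, revenue θ π x ∂μ t - B ≤ ∫ x, f x ∂μ t := by
      have h3 : ∫ x, revenue θ π x ∂μ t - B = ∫ x, (revenue θ π x - B) ∂μ t := by
        rw [integral_sub (integrable_revenue θ π _) (integrable_const _)]
        simp [hμ]
      rw [h3]
      exact integral_mono ((integrable_revenue θ π _).sub (integrable_const B)) hfint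
        fun x => le_max_right _ _
    linarith

theorem abs_postedCost_le (m D : ℕ) (p : ℝ) : |postedCost m D p| ≤ (2 + |p|) * D := by
  have h := norm_integral_le_of_norm_le_const (μ := unifPi m) (C := (2 + |p|) * D)
    (f := fun c : Fin m → ℝ =>
      2 * ((D : ℝ) - (postedWinners c D p).card) + p * (postedWinners c D p).card)
    (ae_of_all _ fun c => by
      have h1 : ((postedWinners c D p).card : ℝ) ≤ D := by
        exact_mod_cast card_postedWinners_le c D p
      have h2 : (0 : ℝ) ≤ (postedWinners c D p).card := Nat.cast_nonneg _
      rw [Real.norm_eq_abs, add_mul]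
      refine (abs_add_le _ _).trans (add_le_add ?_ ?_)
      · rw [abs_of_nonneg (by linarith)]
        linarith
      · rw [abs_mul, abs_of_nonneg h2]
        exact mul_le_mul_of_nonneg_left h1 (abs_nonneg _))
  simpa [postedCost] using h

/-- A posted price policy with static prices has a long-run average profit. -/
theorem hasAverageProfit_posted (θ : ℕ) {π : Policy 1} {r p : Lane 1 → ℝ}
    (hr : ∀ x, π.price x = r) (hπ : π.mech = postedPrice fun _ => p) :
    singleLane.HasAverageProfit θ π
      (∫ x, singleLane.periodProfit θ π x ∂singleLane.nextLaw θ π 0) := by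
  refine hasAverageProfit_of_static hr (by rw [hπ]; exact finitePayments_postedPrice _) ?_
  have h1 : Integrable (fun w : ℕ × ℕ => postedCost w.1 w.2 (p lane))
      (poissonPair θ (θ * sqDemand (π.price 0 lane))) := by
    refine (((integrable_poisson_id _).comp_snd _).const_mul (2 + |p lane|)).mono' .of_discrete
      (ae_of_all _ fun w => ?_)
    exact abs_postedCost_le _ _ _
  have h2 : Integrable (fun x => postedCost (x.1 lane) (x.2 lane) (p lane))
      (singleLane.nextLaw θ π 0) :=
    ((measurePreserving_obs θ π 0).integrable_comp .of_discrete).2 h1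
  exact ((integrable_revenue θ π _).sub h2).congr
    (ae_of_all _ fun x => (periodProfit_of_posted hπ x).symm)

/-! ### The profit of the auction -/

theorem auctionCost_nonneg (m D : ℕ) : 0 ≤ auctionCost m D := by
  refine integral_nonneg_of_ae ?_
  filter_upwards [ae_unifPi m] with c hc
  have h1 : ((auctionWinners c D 1).card : ℝ) ≤ D := by
    exact_mod_cast card_auctionWinners_le c D 1
  have h2 : 0 ≤ ∑ s, auctionPay c D 1 s :=
    Finset.sum_nonneg fun s _ => auctionPay_nonneg (fun s => (hc s).1) D 1 s
  simp only [Pi.zero_apply]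
  linarith

/-- In this product form the means over the independent numbers of carriers and loads factor. -/
theorem auctionCost_le (m D : ℕ) :
    auctionCost m D ≤ ((m : ℝ) + 1)⁻¹ * ((D : ℝ) ^ 2 + D) :=
  (integral_auction_cost_le m D).trans (le_of_eq (by ring))

theorem integrable_auctionBound (θ : ℕ) (d : ℝ) :
    Integrable (fun w : ℕ × ℕ => ((w.1 : ℝ) + 1)⁻¹ * ((w.2 : ℝ) ^ 2 + w.2)) (poissonPair θ d) :=
  (integrable_poisson_inv_succ _).mul_prod
    ((integrable_poisson_sq _).add (integrable_poisson_id _))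

theorem integrable_auctionCost (θ : ℕ) (d : ℝ) :
    Integrable (fun w : ℕ × ℕ => auctionCost w.1 w.2) (poissonPair θ d) :=
  (integrable_auctionBound θ d).mono' .of_discrete (ae_of_all _ fun w => by
    rw [Real.norm_of_nonneg (auctionCost_nonneg _ _)]
    exact auctionCost_le _ _)

theorem integral_auctionCost_le {θ : ℕ} (hθ : 1 ≤ θ) :
    ∫ w, auctionCost w.1 w.2 ∂poissonPair θ θ ≤ θ / 4 + 1 / 2 := by
  have hθ1 : (1 : ℝ) ≤ θ := by exact_mod_cast hθ
  have h1 := integral_poisson_inv_succ_le (θ * 4 : ℝ).toNNReal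
  rw [Real.coe_toNNReal _ (by positivity)] at h1
  set I := ∫ n : ℕ, ((n : ℝ) + 1)⁻¹ ∂poissonMeasure (θ * 4 : ℝ).toNNReal
  calc ∫ w, auctionCost w.1 w.2 ∂poissonPair θ θ
      ≤ ∫ w : ℕ × ℕ, ((w.1 : ℝ) + 1)⁻¹ * ((w.2 : ℝ) ^ 2 + w.2) ∂poissonPair θ θ :=
        integral_mono (integrable_auctionCost θ θ) (integrable_auctionBound θ θ)
          fun w => auctionCost_le _ _
    _ = I * ((θ : ℝ) ^ 2 + θ + θ) := by
        rw [integral_prod_mul (fun n : ℕ => ((n : ℝ) + 1)⁻¹) fun n : ℕ => (n : ℝ) ^ 2 + n,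
          integral_add (integrable_poisson_sq _) (integrable_poisson_id _), integral_poisson_sq,
          integral_poisson_id, Real.coe_toNNReal _ θ.cast_nonneg]
    _ = θ * 4 * I * ((θ + 2) / 4) := by ring
    _ ≤ 1 * ((θ + 2) / 4) := by gcongr
    _ = θ / 4 + 1 / 2 := by ring

/-- The auction, at the shipper price `2`, has a long-run average profit. -/
theorem hasAverageProfit_auction (θ : ℕ) {π : Policy 1} (hr : ∀ x, π.price x = fun _ => 2)
    (hπ : π.mech = unitAuction) :
    singleLane.HasAverageProfit θ π
      (∫ x, singleLane.periodProfit θ π x ∂singleLane.nextLaw θ π 0) := by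
  refine hasAverageProfit_of_static hr (by rw [hπ]; exact finitePayments_unitAuction) ?_
  have h2 : Integrable (fun x => auctionCost (x.1 lane) (x.2 lane))
      (singleLane.nextLaw θ π 0) :=
    ((measurePreserving_obs θ π 0).integrable_comp .of_discrete).2 (integrable_auctionCost _ _)
  exact ((integrable_revenue θ π _).sub h2).congr
    (ae_of_all _ fun x => (periodProfit_of_unitAuction hπ x).symm)

/-- At the shipper price 2 the revenue is exactly `2θ`. The lower bound gives the gap; the upper
bound turns the gap into a relative one. -/
theorem auction_profit_bounds {θ : ℕ} (hθ : 1 ≤ θ) {π : Policy 1}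
    (hr : ∀ x, π.price x = fun _ => 2) (hπ : π.mech = unitAuction) :
    θ * (7 / 4) - 1 / 2 ≤ ∫ x, singleLane.periodProfit θ π x ∂singleLane.nextLaw θ π 0 ∧
      ∫ x, singleLane.periodProfit θ π x ∂singleLane.nextLaw θ π 0 ≤ θ * 2 := by
  have hrev : ∀ x, revenue θ π x = θ * 2 := by
    intro x
    rw [revenue, hr, sqDemand_two]
    ring
  have h2 : Integrable (fun x => auctionCost (x.1 lane) (x.2 lane))
      (singleLane.nextLaw θ π 0) :=
    ((measurePreserving_obs θ π 0).integrable_comp .of_discrete).2 (integrable_auctionCost _ _)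
  have h3 : ∫ x, auctionCost (x.1 lane) (x.2 lane) ∂singleLane.nextLaw θ π 0 =
      ∫ w, auctionCost w.1 w.2 ∂poissonPair θ θ := by
    have h := (measurePreserving_obs θ π 0).integral_comp_of_aestronglyMeasurable
      (g := fun w => auctionCost w.1 w.2) .of_discrete
    rw [hr, sqDemand_two, mul_one] at h
    exact h
  have h4 : ∫ x, singleLane.periodProfit θ π x ∂singleLane.nextLaw θ π 0 =
      θ * 2 - ∫ w, auctionCost w.1 w.2 ∂poissonPair θ θ := by
    simp only [periodProfit_of_unitAuction hπ, hrev]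
    rw [integral_sub (integrable_const _) h2, h3]
    simp
  rw [h4]
  constructor
  · have := integral_auctionCost_le hθ
    linarith
  · have : 0 ≤ ∫ w, auctionCost w.1 w.2 ∂poissonPair θ θ :=
      integral_nonneg fun w => auctionCost_nonneg _ _
    linarith

/-! ### Incentives -/

open Classical in
theorem integrable_setBid_alloc (m : Mechanism 1) (x : State 1) (e : Lane 1) (s : Fin (x.1 e))
    (v : ℝ) :
    Integrable (fun z => if s ∈ m.winners x (setBid z.1 e s v) z.2 e then (1 : ℝ) else 0)
      (singleLane.bidLaw x) := by
  have h : MeasurableSet {z : Bids x × unitInterval | s ∈ m.winners x (setBid z.1 e s v) z.2 e} :=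
    measurable_setBid e s v (m.measurable_winners x e s)
  refine Integrable.of_bound (Measurable.ite h measurable_const
    measurable_const).aestronglyMeasurable 1 (ae_of_all _ fun z => ?_)
  split_ifs <;> simp

open Classical in
theorem interim_utility_eq {m : Mechanism 1} (hfin : singleLane.FinitePayments m) (x : State 1)
    (e : Lane 1) (s : Fin (x.1 e)) {v : ℝ} (hv : v ∈ Icc (0 : ℝ) 1) (c : ℝ) :
    singleLane.interimPay m x e s v - singleLane.interimAlloc m x e s v * c =
      ∫ z, (m.pay x (setBid z.1 e s v) z.2 e s -
        (if s ∈ m.winners x (setBid z.1 e s v) z.2 e then (1 : ℝ) else 0) * c)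
          ∂singleLane.bidLaw x := by
  rw [Market.interimPay, Market.interimAlloc, ← integral_mul_const,
    integral_sub ((hfin x e s).2 v hv) ((integrable_setBid_alloc m x e s v).mul_const c)]

theorem setBid_self_apply {x : State 1} (c : Bids x) (e : Lane 1) (s : Fin (x.1 e)) (v : ℝ) :
    setBid c e s v e = Function.update (c e) s v := by
  simp [setBid]

theorem incentiveCompatible_unitAuction : singleLane.IncentiveCompatible unitAuction := by
  classical
  intro x e s c hc v hv
  have hfin := finitePayments_unitAuction
  rw [interim_utility_eq hfin x e s hv, interim_utility_eq hfin x e s hc]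
  refine integral_mono
    (((hfin x e s).2 v hv).sub ((integrable_setBid_alloc _ x e s v).mul_const c))
    (((hfin x e s).2 c hc).sub ((integrable_setBid_alloc _ x e s c).mul_const c)) fun z => ?_
  have h := auction_truthful (Function.update (z.1 e) s c) (x.2 e) 1 s v
  simp only [Function.update_idem, Function.update_self] at h
  simp only [unitAuction, uniformPriceAuction, setBid_self_apply]
  convert! h

theorem individuallyRational_unitAuction : singleLane.IndividuallyRational unitAuction := by
  classical
  intro x e s c hc
  rw [interim_utility_eq finitePayments_unitAuction x e s hc]
  refine integral_nonneg fun z => ?_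
  have h := auction_utility_nonneg (Function.update (z.1 e) s c) (x.2 e) 1 s
  simp only [Function.update_self] at h
  simp only [unitAuction, uniformPriceAuction, setBid_self_apply, Pi.zero_apply, sub_nonneg]
  convert! h

/-- An individually rational mechanism does not collect money from the carriers. -/
theorem integral_pay_nonneg {m : Mechanism 1} (hfin : singleLane.FinitePayments m)
    (hIR : singleLane.IndividuallyRational m) (x : State 1) (e : Lane 1) (s : Fin (x.1 e)) :
    0 ≤ ∫ z, m.pay x z.1 z.2 e s ∂singleLane.bidLaw x := by
  have hmp := measurePreserving_setBid x e s
  have hint := (hfin x e s).1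
  have hint2 : Integrable (fun w : (Bids x × unitInterval) × ℝ =>
      m.pay x (setBid w.1.1 e s w.2) w.1.2 e s) ((singleLane.bidLaw x).prod unif) :=
    (hmp.integrable_comp hint.aestronglyMeasurable).2 hint
  -- Drawing the bid of `s` afresh turns the ex ante payment into the average of the interim
  -- payments, and individual rationality bounds each of these below by the nonnegative expected
  -- cost of service.
  rw [← hmp.integral_comp_of_aestronglyMeasurable hint.aestronglyMeasurable,
    integral_prod_symm _ hint2]
  refine integral_nonneg_of_ae ?_
  filter_upwards [ae_restrict_mem measurableSet_Icc] with v hv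
  have h1 : 0 ≤ singleLane.interimPay m x e s v - singleLane.interimAlloc m x e s v * v :=
    hIR x e s v hv
  have h2 : 0 ≤ singleLane.interimAlloc m x e s v :=
    integral_nonneg fun z => by
      simp only [Pi.zero_apply]
      split_ifs <;> norm_num
  have h3 := mul_nonneg h2 hv.1
  have h4 : 0 ≤ singleLane.interimPay m x e s v := by linarith
  exact h4

theorem periodProfit_le_revenue {θ : ℕ} {π : Policy 1} (hfin : singleLane.FinitePayments π.mech)
    (hIR : singleLane.IndividuallyRational π.mech) (x : State 1) :
    singleLane.periodProfit θ π x ≤ revenue θ π x := by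
  rw [periodProfit_eq hfin]
  have hcard := ((integrable_const (μ := singleLane.bidLaw x) (x.2 lane : ℝ)).sub
    (integrable_winners_card π.mech x lane)).const_mul 2
  have h1 : Integrable (fun z : Bids x × unitInterval =>
      2 * ((x.2 lane : ℝ) - (π.mech.winners x z.1 z.2 lane).card)) (singleLane.bidLaw x) := hcard
  rw [integral_add h1 (integrable_finsetSum _ fun s _ => (hfin x lane s).1),
    integral_finsetSum _ fun s _ => (hfin x lane s).1]
  have h2 : 0 ≤ ∑ s, ∫ z, π.mech.pay x z.1 z.2 lane s ∂singleLane.bidLaw x :=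
    Finset.sum_nonneg fun s _ => integral_pay_nonneg hfin hIR x lane s
  have h3 : 0 ≤ ∫ z : Bids x × unitInterval,
      2 * ((x.2 lane : ℝ) - (π.mech.winners x z.1 z.2 lane).card) ∂singleLane.bidLaw x :=
    integral_nonneg fun z => by
      have : ((π.mech.winners x z.1 z.2 lane).card : ℝ) ≤ x.2 lane := by
        exact_mod_cast π.mech.card_winners_le x z.1 z.2 lane
      simp only [Pi.zero_apply]
      linarith
  linarith

/-- A crude bound: penalties and expected payments are nonnegative, so profit is at most revenue. It
serves to make the supremum over all auction mechanisms finite. -/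
theorem average_le_of_individuallyRational {θ : ℕ} {π : Policy 1}
    (hIR : singleLane.IndividuallyRational π.mech) {γ : ℝ}
    (hγ : singleLane.HasAverageProfit θ π γ) : γ ≤ θ * 9 := by
  obtain ⟨hfin, h⟩ := hγ
  obtain ⟨hint, hlim⟩ := h 0
  refine average_le_of_shifted (ρ := fun _ => θ * 9) (k := fun _ => 0) (C := θ * 9) (fun t => ?_)
    le_rfl (fun _ => le_rfl) (fun _ => by simp) hlim
  have h2 := integral_mono (hint t) (integrable_const (θ * 9 : ℝ)) fun x =>
    (periodProfit_le_revenue hfin hIR x).trans (revenue_le θ π x)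
  simpa using h2

end Freight

/-! ### Comparison of the auction with posted prices -/

open Freight in
theorem theorem4 :
    ∃ (n : ℕ) (M : Freight.Market n),
      M.UniformCosts ∧ (∀ e, M.stay e = 0) ∧ (∃ z, M.FluidOptimal z) ∧
      ∀ (z : Freight.FluidPoint n) (hz : M.FluidOptimal z),
        0 < M.fluidProfit z ∧
        ∃ γSP γAUC : ℕ → ℝ,
          (∀ θ : ℕ, 1 ≤ θ → M.HasAverageProfit θ (M.staticPosted z hz.1) (γSP θ)) ∧
          (∀ θ : ℕ, 1 ≤ θ → M.HasAverageProfit θ (M.staticAuction z hz.1) (γAUC θ)) ∧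
          (∃ c : ℝ, 0 < c ∧ ∀ᶠ θ : ℕ in atTop, c * √θ ≤ γAUC θ - γSP θ) ∧
          (∃ c : ℝ, 0 < c ∧ ∀ᶠ θ : ℕ in atTop, 0 < γAUC θ ∧ γSP θ / γAUC θ ≤ 1 - c / √θ) ∧
          (∃ c : ℝ, 0 < c ∧ ∀ᶠ θ : ℕ in atTop, ∃ U V : ℝ,
            IsLUB (M.auctionProfits z θ) U ∧ IsLUB (M.postedProfits θ) V ∧
              c * √θ ≤ U - V) := by
  refine ⟨1, singleLane, singleLane_uniformCosts, fun _ => rfl,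
    ⟨_, fluidSolution_optimal⟩, fun z hz => ?_⟩
  obtain rfl := eq_fluidSolution hz
  refine ⟨by rw [fluidProfit_fluidSolution]; norm_num, ?_⟩
  set SP := singleLane.staticPosted fluidSolution hz.1 with hSPdef
  set AUC := singleLane.staticAuction fluidSolution hz.1 with hAUCdef
  have hAUCprice : ∀ x, AUC.price x = fun _ => 2 := fun _ => shipperPrice_fluidSolution
  have hAUCmech : AUC.mech = unitAuction := by
    rw [hAUCdef, Market.staticAuction, reserve_fluidSolution]
  let γSP : ℕ → ℝ := fun θ => ∫ x, singleLane.periodProfit θ SP x ∂singleLane.nextLaw θ SP 0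
  let γAUC : ℕ → ℝ := fun θ => ∫ x, singleLane.periodProfit θ AUC x ∂singleLane.nextLaw θ AUC 0
  have hSP : ∀ θ, singleLane.HasAverageProfit θ SP (γSP θ) := fun θ =>
    hasAverageProfit_posted θ (fun _ => rfl) rfl
  have hAUC : ∀ θ, singleLane.HasAverageProfit θ AUC (γAUC θ) := fun θ =>
    hasAverageProfit_auction θ hAUCprice hAUCmech
  have hpos := postedLoss_pos
  -- Half of the posted price loss eventually absorbs the constant loss `1/2` of the auction; the
  -- other half is the gap.
  have hlarge : ∀ᶠ θ : ℕ in atTop, 1 ≤ θ ∧ 1 / 2 ≤ postedLoss / 2 * √(θ : ℝ) := by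
    have h1 : Tendsto (fun θ : ℕ => postedLoss / 2 * √(θ : ℝ)) atTop atTop :=
      (Real.tendsto_sqrt_atTop.comp tendsto_natCast_atTop_atTop).const_mul_atTop (by positivity)
    exact (eventually_ge_atTop 1).and (h1.eventually_ge_atTop _)
  have hgap : ∀ θ : ℕ, 1 ≤ θ → 1 / 2 ≤ postedLoss / 2 * √(θ : ℝ) →
      θ * (7 / 4) - postedLoss * √(θ : ℝ) + postedLoss / 2 * √(θ : ℝ) ≤ γAUC θ := by
    intro θ h1 h2
    have := (auction_profit_bounds h1 hAUCprice hAUCmech).1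
    simp only [γAUC]
    linarith
  refine ⟨γSP, γAUC, fun θ _ => hSP θ, fun θ _ => hAUC θ,
    ⟨postedLoss / 2, by positivity, ?_⟩, ⟨postedLoss / 4, by positivity, ?_⟩,
    ⟨postedLoss / 2, by positivity, ?_⟩⟩
  · filter_upwards [hlarge] with θ ⟨h1, h2⟩
    have h3 := posted_average_le h1 (p := fun _ => singleLane.fluidCarrierPrice fluidSolution) rfl
      (hSP θ)
    linarith [hgap θ h1 h2]
  · filter_upwards [hlarge] with θ ⟨h1, h2⟩
    have hθ : (1 : ℝ) ≤ θ := by exact_mod_cast h1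
    have h3 := posted_average_le h1 (p := fun _ => singleLane.fluidCarrierPrice fluidSolution) rfl
      (hSP θ)
    have h4 := hgap θ h1 h2
    obtain ⟨h5, h6⟩ := auction_profit_bounds h1 hAUCprice hAUCmech
    have hA : 0 < γAUC θ := lt_of_lt_of_le (by linarith) h5
    refine ⟨hA, ?_⟩
    have hs : 0 < √(θ : ℝ) := Real.sqrt_pos.2 (by linarith)
    have hss : √(θ : ℝ) * √(θ : ℝ) = θ := Real.mul_self_sqrt (by linarith)
    -- Since the auction earns at most `2θ`, a relative loss of `postedLoss / 4 / √θ` amounts to at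
    -- most the absolute gap.
    have h7 : postedLoss / 4 / √(θ : ℝ) * γAUC θ ≤ postedLoss / 2 * √(θ : ℝ) := by
      have h8 : postedLoss / 4 / √(θ : ℝ) * γAUC θ ≤ postedLoss / 4 / √(θ : ℝ) * (θ * 2) :=
        mul_le_mul_of_nonneg_left h6 (by positivity)
      refine h8.trans (le_of_eq ?_)
      rw [div_mul_eq_mul_div, div_eq_iff hs.ne']
      linear_combination (-postedLoss / 2) * hss
    rw [div_le_iff₀ hA, sub_mul, one_mul]
    linarith
  · filter_upwards [hlarge] with θ ⟨h1, h2⟩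
    have hmemA : γAUC θ ∈ singleLane.auctionProfits fluidSolution θ :=
      ⟨AUC, rfl, by rw [hAUCmech]; exact incentiveCompatible_unitAuction,
        by rw [hAUCmech]; exact individuallyRational_unitAuction, hAUC θ⟩
    have hbddA : BddAbove (singleLane.auctionProfits fluidSolution θ) := by
      refine ⟨θ * 9, ?_⟩
      rintro γ ⟨π, -, -, hIR, hγ⟩
      exact average_le_of_individuallyRational hIR hγ
    have hmemP : γSP θ ∈ singleLane.postedProfits θ := ⟨SP, ⟨_, rfl⟩, hSP θ⟩
    have hboundP : ∀ γ ∈ singleLane.postedProfits θ,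
        γ ≤ θ * (7 / 4) - postedLoss * √(θ : ℝ) := by
      rintro γ ⟨π, ⟨p, hp⟩, hγ⟩
      exact posted_average_le h1 hp hγ
    refine ⟨_, _, isLUB_csSup ⟨_, hmemA⟩ hbddA, isLUB_csSup ⟨_, hmemP⟩ ⟨_, hboundP⟩, ?_⟩
    have h3 := le_csSup hbddA hmemA
    have h4 := csSup_le ⟨_, hmemP⟩ hboundP
    linarith [hgap θ h1 h2]
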